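/- **Setting.** Consider a single bosonic mode with Hilbert space $L^2(\mathbb R)$, $\hat a=(\hat q+i\hat p)/\sqrt2$, $[\hat q,\hat p]=i$, displacement operators $D(\alpha)=\exp(\alpha\hat a^\dagger-\alpha^*\hat a)$, coherent states $|\alpha\rangle=D(\alpha)|0\rangle$, and Weyl characteristic function $\chi(\xi;\rho)=\operatorname{Tr}[D(\xi_1+i\xi_2)\rho]$, $\xi\in\mathbb R^2$. A state $\rho$ is *classical* if its Sudarshan–Glauber diagonal weight is a probability distribution, i.e. $\rho=\int|\alpha\rangle\langle\alpha|\,d\mu(\alpha)$ for a probability measure $\mu$ on $\mathbb C$. A channel (completely positive trace-preserving linear map on trace-class operators) is *nonclassicality breaking* (NB) if it maps every state to a classical state. It is *Gaussian with parameters $(X,Y)$*, where $X,Y$ are real $2\times2$ matrices and $Y$ is symmetric, if $\chi(\xi;\Gamma(\rho))=\chi(X\xi;\rho)\,e^{-\xi^TY\xi/2}$ for all states $\rho$ and all $\xi$. Say that $(X,Y)$ *has the form* $(X_0,Y_0)$ if $X_0=SXR$ and $Y_0=R^TYR$ for some $S\in Sp(2,\mathbb R)$ and $R\in SO(2)$.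 Let $\sigma_3=\mathrm{diag}(1,-1)$. **Theorem.** Let $\Gamma$ be a Gaussian channel with parameters $(X,Y)$. 0. If $\det X>0$, then $(X,Y)$ has the form $(\kappa\mathbb 1,\mathrm{diag}(a,b))$ for some $\kappa>0$ and $a,b\in\mathbb R$; if $\det X<0$, it has the form $(\kappa\sigma_3,\mathrm{diag}(a,b))$ for some $\kappa>0$ and $a,b\in\mathbb R$; if $\det X=0$ and $X\ne0$, it has the form $(\mathrm{diag}(1,0),Y_0)$ for some $Y_0$; if $X=0$, it has the form $(0,\mathrm{diag}(a,b))$ for some $a,b\in\mathbb R$. 1. If $(X,Y)$ has the form $(\kappa\mathbb 1,\mathrm{diag}(a,b))$ with $\kappa>0$, then $\Gamma$ is NB if and only if $a>1$, $b>1$ and $(a-1)(b-1)\ge\kappa^4$; equivalently, if and only if $\tilde a:=a+\kappa^2-1>0$, $\tilde b:=b+\kappa^2-1>0$ and $1/\tilde a+1/\tilde b\le1/\kappa^2$. Unless $a=b=1-\kappa^2$ (the pure-loss attenuators and the identity-type channel $\kappa=1$, $a=b=0$), the single inequality $(a-1)(b-1)\ge\kappa^4$ is already necessary and sufficient for $\Gamma$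 to be NB. 2. If $(X,Y)$ has the form $(\kappa\sigma_3,\mathrm{diag}(a,b))$ with $\kappa>0$, then $\Gamma$ is NB if and only if $(a-1)(b-1)\ge\kappa^4$; equivalently, if and only if $\tilde a>0$, $\tilde b>0$ and $1/\tilde a+1/\tilde b\le1/\kappa^2$, with $\tilde a,\tilde b$ as in 1. 3. If $(X,Y)$ has the form $(\mathrm{diag}(1,0),Y_0)$, then $\Gamma$ is NB if and only if $Y_0\ge\mathbb 1$; equivalently, if and only if both eigenvalues of $Y$ are $\ge1$. If $(X,Y)$ has the form $(0,\mathrm{diag}(a,b))$, then $\Gamma$ is NB if and only if $a\ge1$ and $b\ge1$. -/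

import Mathlib

open MeasureTheory Matrix
open scoped ComplexOrder InnerProductSpace ENNReal

noncomputable section

namespace SingleMode

/-! ### The Hilbert space, displacement operators and coherent states -/

/-- The Hilbert space `L²(ℝ; ℂ)` of a single bosonic mode. -/
abbrev Mode : Type := Lp ℂ 2 (volume : Measure ℝ)

/-- The pointwise action of the Weyl displacement operator in the Schrödinger representation. With
`â = (q̂ + i p̂)/√2`, `[q̂, p̂] = i` and `α = α₁ + i α₂` one has
`D(α) = exp(α â† - α* â) = exp(i√2 (α₂ q̂ - α₁ p̂))`, that is,
`(D(α) ψ)(x) = exp(i (√2 α₂ x - α₁ α₂)) ψ(x - √2 α₁)`. -/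
def displaceFun (α : ℂ) (f : ℝ → ℂ) (x : ℝ) : ℂ :=
  Complex.exp (((√2 * α.im * x - α.re * α.im : ℝ) : ℂ) * Complex.I) * f (x - √2 * α.re)

theorem norm_displaceFun (α : ℂ) (f : ℝ → ℂ) (x : ℝ) :
    ‖displaceFun α f x‖ = ‖f (x - √2 * α.re)‖ := by
  rw [displaceFun, norm_mul, Complex.norm_exp_ofReal_mul_I, one_mul]

theorem mp_shift (α : ℂ) :
    MeasurePreserving (fun x : ℝ => x - √2 * α.re) volume volume :=
  measurePreserving_sub_right volume _

theorem aestronglyMeasurable_displaceFun (α : ℂ) {f : ℝ → ℂ}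
    (hf : AEStronglyMeasurable f volume) :
    AEStronglyMeasurable (displaceFun α f) volume := by
  have h1 : Continuous fun x : ℝ =>
      Complex.exp (((√2 * α.im * x - α.re * α.im : ℝ) : ℂ) * Complex.I) := by fun_prop
  exact h1.aestronglyMeasurable.mul (hf.comp_measurePreserving (mp_shift α))

theorem eLpNorm_displaceFun (α : ℂ) {f : ℝ → ℂ} (hf : AEStronglyMeasurable f volume) :
    eLpNorm (displaceFun α f) 2 volume = eLpNorm f 2 volume := by
  rw [← eLpNorm_comp_measurePreserving hf (mp_shift α)]
  exact eLpNorm_congr_norm_ae (Filter.Eventually.of_forall fun x => norm_displaceFun α f x)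

theorem memLp_displaceFun (α : ℂ) {f : ℝ → ℂ} (hf : MemLp f 2 volume) :
    MemLp (displaceFun α f) 2 volume :=
  ⟨aestronglyMeasurable_displaceFun α hf.1, by rw [eLpNorm_displaceFun α hf.1]; exact hf.2⟩

/-- The displacement operator `D(α)` as a linear isometry of `L²(ℝ; ℂ)`. -/
def displacementIsometry (α : ℂ) : Mode →ₗᵢ[ℂ] Mode where
  toFun ψ := (memLp_displaceFun α (Lp.memLp ψ)).toLp _
  map_add' ψ φ := by
    rw [← MemLp.toLp_add]
    refine MemLp.toLp_congr _ _ ?_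
    filter_upwards [(mp_shift α).quasiMeasurePreserving.ae_eq_comp (Lp.coeFn_add ψ φ)] with x hx
    simp only [Function.comp_apply, Pi.add_apply] at hx
    simp only [displaceFun, Pi.add_apply, hx, mul_add]
  map_smul' c ψ := by
    rw [RingHom.id_apply, ← MemLp.toLp_const_smul]
    refine MemLp.toLp_congr _ _ ?_
    filter_upwards [(mp_shift α).quasiMeasurePreserving.ae_eq_comp (Lp.coeFn_smul c ψ)] with x hx
    simp only [Function.comp_apply, Pi.smul_apply, smul_eq_mul] at hx
    simp only [displaceFun, Pi.smul_apply, smul_eq_mul, hx]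
    ring
  norm_map' ψ := by
    change ‖(memLp_displaceFun α (Lp.memLp ψ)).toLp _‖ = ‖ψ‖
    rw [Lp.norm_toLp, eLpNorm_displaceFun α (Lp.memLp ψ).1, Lp.norm_def]

/-- The displacement operator `D(α)` as a bounded operator. -/
def displacement (α : ℂ) : Mode →L[ℂ] Mode :=
  (displacementIsometry α).toContinuousLinearMap

/-- The ground state wave function `π^(-1/4) exp(-x²/2)` of the oscillator. -/
def vacuumFun (x : ℝ) : ℂ := ((Real.pi ^ (-(1 / 4) : ℝ) * Real.exp (-x ^ 2 / 2) : ℝ) : ℂ)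

theorem memLp_vacuumFun : MemLp vacuumFun 2 (volume : Measure ℝ) := by
  have hc : Continuous vacuumFun := by unfold vacuumFun; fun_prop
  rw [memLp_two_iff_integrable_sq_norm hc.aestronglyMeasurable]
  have h := (integrable_exp_neg_mul_sq (b := 1) one_pos).const_mul
    ((Real.pi ^ (-(1 / 4) : ℝ)) ^ 2)
  refine h.congr (Filter.Eventually.of_forall fun x => ?_)
  simp only [vacuumFun, Complex.norm_real, Real.norm_eq_abs, sq_abs, mul_pow, ← Real.exp_nat_mul]
  congr 2
  push_cast
  ring

/-- The vacuum state vector `|0⟩`. -/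
def vacuum : Mode := memLp_vacuumFun.toLp vacuumFun

/-- The coherent state vector `|α⟩ = D(α)|0⟩`. -/
def coherent (α : ℂ) : Mode := displacement α vacuum

/-! ### Trace, density operators, characteristic function, classicality -/

/-- The operator `T` has trace `z`: for every orthonormal (Hilbert) basis the sum of the diagonal
matrix elements converges (unconditionally) to `z`. -/
def HasTrace (T : Mode →L[ℂ] Mode) (z : ℂ) : Prop :=
  ∀ (ι : Type) (b : HilbertBasis ι ℂ Mode), HasSum (fun i => ⟪b i, T (b i)⟫_ℂ) z

open Classical in
/-- The trace of an operator (`0` if the operator has no trace). -/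
def trace (T : Mode →L[ℂ] Mode) : ℂ :=
  if h : ∃ z, HasTrace T z then h.choose else 0

/-- Density operators (states): positive operators of trace one. -/
def IsDensity (ρ : Mode →L[ℂ] Mode) : Prop := ρ.IsPositive ∧ HasTrace ρ 1

/-- The space of trace-class operators: the linear span of the density operators (every trace-class
operator is a linear combination of four positive ones). -/
def traceClass : Submodule ℂ (Mode →L[ℂ] Mode) := Submodule.span ℂ {ρ | IsDensity ρ}

/-- A density operator, regarded as a trace-class operator. -/
def IsDensity.toTraceClass {ρ : Mode →L[ℂ] Mode} (hρ : IsDensity ρ) : traceClass :=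
  ⟨ρ, Submodule.subset_span hρ⟩

/-- The symmetric-ordered (Weyl, Wigner) characteristic function `χ_W(ξ; ρ) = Tr[D(ξ) ρ]`, where
`ξ = (ξ₁, ξ₂) ∈ ℝ²` is identified with `ξ₁ + i ξ₂ ∈ ℂ`. -/
def weylChar (ρ : Mode →L[ℂ] Mode) (ξ : Fin 2 → ℝ) : ℂ :=
  trace (displacement (⟨ξ 0, ξ 1⟩ : ℂ) ∘L ρ)

/-- `ρ` is classical: its diagonal (Sudarshan–Glauber) weight is a genuine probability distribution,
`ρ = ∫ |α⟩⟨α| dμ(α)` (as a weak integral) for some probability measure `μ` on `ℂ`. -/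
def IsClassical (ρ : Mode →L[ℂ] Mode) : Prop :=
  ∃ μ : Measure ℂ, IsProbabilityMeasure μ ∧
    ∀ f g : Mode, ⟪f, ρ g⟫_ℂ = ∫ α, ⟪f, coherent α⟫_ℂ * ⟪coherent α, g⟫_ℂ ∂μ

/-! ### Channels -/

/-- Quantum channels: completely positive, trace-preserving linear maps on trace-class operators.
Complete positivity is stated with block operators `(T i j)` on `Modeⁿ`. -/
structure IsChannel (Γ : traceClass →ₗ[ℂ] traceClass) : Prop where
  completely_positive : ∀ (n : ℕ) (T : Fin n → Fin n → traceClass),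
    (∀ v : Fin n → Mode, 0 ≤ ∑ i, ∑ j, ⟪v i, (T i j : Mode →L[ℂ] Mode) (v j)⟫_ℂ) →
    ∀ v : Fin n → Mode, 0 ≤ ∑ i, ∑ j, ⟪v i, (Γ (T i j) : Mode →L[ℂ] Mode) (v j)⟫_ℂ
  trace_preserving : ∀ T : traceClass,
    trace (Γ T : Mode →L[ℂ] Mode) = trace (T : Mode →L[ℂ] Mode)

/-- `Γ` is a Gaussian channel described by the pair `(X, Y)` of real `2 × 2` matrices, `Y`
symmetric: `χ_W^out(ξ) = χ_W^in(X ξ) exp(-ξᵀ Y ξ / 2)` for every input state. -/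
structure IsGaussianChannel (Γ : traceClass →ₗ[ℂ] traceClass)
    (X Y : Matrix (Fin 2) (Fin 2) ℝ) : Prop extends IsChannel Γ where
  symm : Y.IsSymm
  weylChar_out : ∀ (ρ : Mode →L[ℂ] Mode) (hρ : IsDensity ρ) (ξ : Fin 2 → ℝ),
    weylChar (Γ hρ.toTraceClass) ξ =
      weylChar ρ (X *ᵥ ξ) * ((Real.exp (-(ξ ⬝ᵥ Y *ᵥ ξ) / 2) : ℝ) : ℂ)

/-- `Γ` is nonclassicality breaking: every output state is classical. -/
def NonclassicalityBreaking (Γ : traceClass →ₗ[ℂ] traceClass) : Prop :=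
  ∀ (ρ : Mode →L[ℂ] Mode) (hρ : IsDensity ρ), IsClassical (Γ hρ.toTraceClass)

/-! ### Canonical forms -/

/-- The symplectic form `β` on `ℝ²`. -/
def symplecticForm : Matrix (Fin 2) (Fin 2) ℝ := !![0, 1; -1, 0]

/-- `(X₀, Y₀)` lies in the nonclassicality orbit of `(X, Y)`:
`(X₀, Y₀) = (S X R, Rᵀ Y R)` with `S ∈ Sp(2, ℝ)` and `R ∈ SO(2)`. -/
def HasForm (X Y X₀ Y₀ : Matrix (Fin 2) (Fin 2) ℝ) : Prop :=
  ∃ S R : Matrix (Fin 2) (Fin 2) ℝ, S * symplecticForm * Sᵀ = symplecticForm ∧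
    R ∈ Matrix.specialOrthogonalGroup (Fin 2) ℝ ∧ S * X * R = X₀ ∧ Rᵀ * Y * R = Y₀

/-- The Pauli matrix `σ₃ = diag(1, -1)`. -/
def sigma3 : Matrix (Fin 2) (Fin 2) ℝ := diagonal ![1, -1]

end SingleMode

end

open SingleMode

/-!
Write `Z = Y - 1`. A state is classical iff its characteristic function times `exp (|ξ|² / 2)`,
which is the Fourier transform of its diagonal weight, is positive definite (Bochner's theorem,
together with the fact that coherent states determine an operator). Hence the channel is
nonclassicality breaking iff `χ(X ξ; ρ) exp (-ξᵀ Z ξ / 2)` is positive definite for every state `ρ`.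

For sufficiency, the kernel `χ(X (zᵢ - zⱼ); ρ)` is positive definite up to the phase
`exp (i det X · symp zᵢ zⱼ)`, where `symp` is the symplectic form, and the Gaussian kernel absorbs
this phase when `Z ± i det X · Ω ≥ 0` with `Ω` the matrix of that form, that is, when `Z ≥ 0` and
`det X ^ 2 ≤ det Z`.

For necessity, a sum of displaced vacua is an approximate eigenvector of a displacement, which makes
`exp (-ξᵀ Z ξ / 2)` bounded and so `Z ≥ 0`. The determinant inequality comes from the odd cat state
`|β⟩ - |-β⟩` with `XᵀX + Z` normalised to `1`, by integrating against a Gaussian.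

Finally, complete positivity tested on the operators `D(-X zᵢ)|0⟩⟨0|D(-X zⱼ)†` gives the uncertainty
relation `(1 - det X) ^ 2 ≤ det Y`. It rules out `a, b < 1` in the canonical forms, except for pure
loss.
-/

namespace SingleMode

/-! ### Displacement operators -/

/-- The symplectic form of phase space, with `ξ ∈ ℝ²` read as `ξ₁ + i ξ₂ ∈ ℂ`; it is the phase in
the composition law of displacement operators. -/
noncomputable def symp : ℂ →ₗ[ℝ] ℂ →ₗ[ℝ] ℝ :=
  LinearMap.mk₂ ℝ (fun ξ η => ξ.im * η.re - ξ.re * η.im)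
    (fun ξ ξ' η => by simp only [Complex.add_re, Complex.add_im]; ring)
    (fun c ξ η => by simp only [Complex.smul_re, Complex.smul_im, smul_eq_mul]; ring)
    (fun ξ η η' => by simp only [Complex.add_re, Complex.add_im]; ring)
    (fun c ξ η => by simp only [Complex.smul_re, Complex.smul_im, smul_eq_mul]; ring)

theorem symp_apply (ξ η : ℂ) : symp ξ η = ξ.im * η.re - ξ.re * η.im := rfl

@[simp]
theorem symp_self (ξ : ℂ) : symp ξ ξ = 0 := by
  rw [symp_apply, mul_comm, sub_self]

theorem symp_swap (ξ η : ℂ) : symp ξ η = -symp η ξ := by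
  simp only [symp_apply]
  ring

theorem displacement_coeFn (α : ℂ) (ψ : Mode) :
    displacement α ψ =ᵐ[volume] displaceFun α ψ :=
  MemLp.coeFn_toLp (memLp_displaceFun α (Lp.memLp ψ))

theorem displaceFun_congr_ae (α : ℂ) {f g : ℝ → ℂ} (h : f =ᵐ[volume] g) :
    displaceFun α f =ᵐ[volume] displaceFun α g := by
  filter_upwards [(mp_shift α).quasiMeasurePreserving.ae_eq_comp h] with x hx
  simp only [Function.comp_apply] at hx
  simp only [displaceFun, hx]

theorem displaceFun_displaceFun (α β : ℂ) (f : ℝ → ℂ) (x : ℝ) :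
    displaceFun α (displaceFun β f) x =
      Complex.exp (symp α β * Complex.I) * displaceFun (α + β) f x := by
  have sqrt_two_mul_self : √2 * √2 = (2 : ℝ) := Real.mul_self_sqrt zero_le_two
  simp only [displaceFun, ← mul_assoc, ← Complex.exp_add, ← add_mul, Complex.add_re,
    Complex.add_im, symp_apply]
  congr 1
  · congr 2
    norm_cast
    linear_combination (-α.re * β.im) * sqrt_two_mul_self
  · congr 1
    ring

theorem displacement_displacement (α β : ℂ) (ψ : Mode) :
    displacement α (displacement β ψ) =
      Complex.exp (symp α β * Complex.I) • displacement (α + β) ψ := by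
  apply Lp.ext
  filter_upwards [displacement_coeFn α (displacement β ψ),
    displaceFun_congr_ae α (displacement_coeFn β ψ), displacement_coeFn (α + β) ψ,
    Lp.coeFn_smul (Complex.exp (symp α β * Complex.I)) (displacement (α + β) ψ)]
    with x h_outer h_inner h_add h_smul
  rw [h_outer, h_inner, h_smul, Pi.smul_apply, h_add, displaceFun_displaceFun, smul_eq_mul]

@[simp]
theorem displacement_zero (ψ : Mode) : displacement 0 ψ = ψ := by
  apply Lp.ext
  filter_upwards [displacement_coeFn 0 ψ] with x hx
  simp [hx, displaceFun]

@[simp]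
theorem displacement_neg_displacement (α : ℂ) (ψ : Mode) :
    displacement (-α) (displacement α ψ) = ψ := by
  simp [displacement_displacement]

@[simp]
theorem displacement_displacement_neg (α : ℂ) (ψ : Mode) :
    displacement α (displacement (-α) ψ) = ψ := by
  simp [displacement_displacement]

@[simp]
theorem norm_displacement (α : ℂ) (ψ : Mode) : ‖displacement α ψ‖ = ‖ψ‖ :=
  (displacementIsometry α).norm_map ψ

@[simp]
theorem inner_displacement_displacement (α : ℂ) (u v : Mode) :
    ⟪displacement α u, displacement α v⟫_ℂ = ⟪u, v⟫_ℂ :=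
  (displacementIsometry α).inner_map_map u v

theorem inner_displacement_left (α : ℂ) (u v : Mode) :
    ⟪displacement α u, v⟫_ℂ = ⟪u, displacement (-α) v⟫_ℂ := by
  rw [← inner_displacement_displacement (-α), displacement_neg_displacement]

/-- The displacement operator `D(α)` as a unitary, used to move Hilbert bases. -/
noncomputable def displacementEquiv (α : ℂ) : Mode ≃ₗᵢ[ℂ] Mode where
  toLinearEquiv := LinearEquiv.ofLinearMap (displacement α).toLinearMap
    (displacement (-α)).toLinearMap (by ext1 ψ; simp) (by ext1 ψ; simp)
  norm_map' := norm_displacement α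

theorem inner_displacement_eq_integral (α : ℂ) (u v : Mode) :
    ⟪u, displacement α v⟫_ℂ = ∫ x : ℝ, starRingEnd ℂ (u x) * displaceFun α v x := by
  rw [L2.inner_def]
  refine integral_congr_ae ?_
  filter_upwards [displacement_coeFn α v] with x hx
  rw [hx, RCLike.inner_apply, mul_comm]

theorem continuous_of_norm_eq_of_continuous_inner {𝕜 E X : Type*} [RCLike 𝕜]
    [NormedAddCommGroup E] [InnerProductSpace 𝕜 E] [TopologicalSpace X] {f : X → E} {r : ℝ}
    (norm_eq : ∀ x, ‖f x‖ = r) (weak : ∀ u, Continuous fun x => inner 𝕜 u (f x)) :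
    Continuous f := by
  rw [continuous_iff_continuousAt]
  intro x₀
  rw [ContinuousAt, tendsto_iff_norm_sub_tendsto_zero]
  have norm_sub_eq (x : X) :
      ‖f x - f x₀‖ = √(2 * r ^ 2 - 2 * RCLike.re (inner 𝕜 (f x₀) (f x))) := by
    rw [eq_comm, ← Real.sqrt_sq (norm_nonneg (f x - f x₀)), norm_sub_sq (𝕜 := 𝕜), norm_eq,
      norm_eq, inner_re_symm]
    congr 1
    ring
  have continuous_norm_sub : Continuous fun x => ‖f x - f x₀‖ := by
    simp_rw [norm_sub_eq]
    exact (continuous_const.sub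
      (continuous_const.mul (RCLike.continuous_re.comp (weak (f x₀))))).sqrt
  simpa using continuous_norm_sub.tendsto x₀

theorem continuous_displacement_ofReal (ψ : Mode) :
    Continuous fun a : ℝ => displacement (a : ℂ) ψ := by
  let shift : ℝ → C(ℝ, ℝ) := fun a => ⟨fun x => x - √2 * a, by fun_prop⟩
  have continuous_shift : Continuous shift :=
    ContinuousMap.continuous_of_continuous_uncurry _ (by
      change Continuous fun p : ℝ × ℝ => p.2 - √2 * p.1
      fun_prop)
  have mp (a : ℝ) : MeasurePreserving (shift a) volume volume :=
    measurePreserving_sub_right volume _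
  refine ((continuous_const (y := ψ)).compMeasurePreservingLp continuous_shift mp
    (by simp)).congr fun a => Lp.ext ?_
  filter_upwards [displacement_coeFn (a : ℂ) ψ, Lp.coeFn_compMeasurePreserving ψ (mp a)]
    with x h_displacement h_comp
  rw [h_displacement, h_comp]
  simp [displaceFun, shift]

theorem continuous_displacement_ofReal_mul_I (ψ : Mode) :
    Continuous fun b : ℝ => displacement (b * Complex.I) ψ := by
  refine continuous_of_norm_eq_of_continuous_inner (𝕜 := ℂ) (r := ‖ψ‖)
    (fun _ => norm_displacement _ ψ) fun u => ?_
  simp_rw [inner_displacement_eq_integral]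
  refine continuous_of_dominated (bound := fun x => ‖⟪u x, ψ x⟫_ℂ‖) (fun b => ?_)
    (fun b => Filter.Eventually.of_forall fun x => ?_) (L2.integrable_inner u ψ).norm
    (Filter.Eventually.of_forall fun x => ?_)
  · exact (RCLike.continuous_conj.comp_aestronglyMeasurable (Lp.aestronglyMeasurable u)).mul
      (aestronglyMeasurable_displaceFun _ (Lp.aestronglyMeasurable ψ))
  · rw [norm_mul, norm_displaceFun, RCLike.inner_apply, norm_mul, mul_comm]
    simp
  · simp only [displaceFun, Complex.re_ofReal_mul, Complex.I_re, mul_zero, sub_zero]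
    fun_prop

theorem continuous_displacement (ψ : Mode) : Continuous fun α : ℂ => displacement α ψ := by
  refine continuous_of_norm_eq_of_continuous_inner (𝕜 := ℂ) (r := ‖ψ‖)
    (fun α => norm_displacement α ψ) fun u => ?_
  have split_re_im (α : ℂ) : ⟪u, displacement α ψ⟫_ℂ =
      Complex.exp (((-α.im * α.re : ℝ) : ℂ) * Complex.I) *
        ⟪displacement ((-α.im : ℝ) * Complex.I) u, displacement (α.re : ℂ) ψ⟫_ℂ := by
    have neg_im_add_re : -((-α.im : ℝ) * Complex.I) + (α.re : ℂ) = α := by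
      apply Complex.ext <;> simp
    rw [inner_displacement_left, displacement_displacement, inner_smul_right, ← mul_assoc,
      ← Complex.exp_add, neg_im_add_re]
    simp [symp_apply]
  simp_rw [split_re_im]
  have continuous_left := (continuous_displacement_ofReal_mul_I u).comp Complex.continuous_im.neg
  have continuous_right := (continuous_displacement_ofReal ψ).comp Complex.continuous_re
  exact Continuous.mul (by fun_prop) (continuous_left.inner continuous_right)

/-! ### Coherent states -/

theorem vacuum_coeFn : vacuum =ᵐ[volume] vacuumFun := memLp_vacuumFun.coeFn_toLp

theorem vacuumFun_mul_displaceFun_vacuumFun (α : ℂ) (x : ℝ) :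
    starRingEnd ℂ (vacuumFun x) * displaceFun α vacuumFun x =
      ((Real.pi ^ (-(1 / 2) : ℝ) : ℝ) : ℂ) * Complex.exp (-1 * (x : ℂ) ^ 2 + (√2 : ℝ) * α * x +
        (-(α.re : ℂ) ^ 2 - α.re * α.im * Complex.I)) := by
  have sqrt_two_mul_self : ((√2 : ℝ) : ℂ) * (√2 : ℝ) = 2 := by
    exact_mod_cast Real.mul_self_sqrt zero_le_two
  have exponent_eq : -1 * (x : ℂ) ^ 2 + (√2 : ℝ) * α * x +
      (-(α.re : ℂ) ^ 2 - α.re * α.im * Complex.I) = -(x : ℂ) ^ 2 / 2 +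
        ((√2 : ℝ) * α.im * x - α.re * α.im) * Complex.I + -(x - (√2 : ℝ) * α.re) ^ 2 / 2 := by
    linear_combination ((√2 : ℝ) * (x : ℂ)) * (Complex.re_add_im α).symm +
      ((α.re : ℂ) ^ 2 / 2) * sqrt_two_mul_self
  have normalization : (Real.pi ^ (-(1 / 2) : ℝ) : ℝ) =
      Real.pi ^ (-(1 / 4) : ℝ) * Real.pi ^ (-(1 / 4) : ℝ) := by
    rw [← Real.rpow_add Real.pi_pos]
    norm_num
  rw [exponent_eq, normalization, Complex.exp_add, Complex.exp_add]
  simp only [displaceFun, vacuumFun, Complex.conj_ofReal]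
  push_cast
  ring

theorem inner_vacuum_displacement_vacuum (α : ℂ) :
    ⟪vacuum, displacement α vacuum⟫_ℂ = Real.exp (-‖α‖ ^ 2 / 2) := by
  have integrand_eq : (fun x : ℝ => starRingEnd ℂ (vacuum x) * displaceFun α vacuum x) =ᵐ[volume]
      fun x => starRingEnd ℂ (vacuumFun x) * displaceFun α vacuumFun x := by
    filter_upwards [vacuum_coeFn, displaceFun_congr_ae α vacuum_coeFn] with x h h_displace
    rw [h, h_displace]
  have normalization : ((Real.pi ^ (-(1 / 2) : ℝ) : ℝ) : ℂ) * (Real.pi : ℂ) ^ (1 / 2 : ℂ) = 1 := by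
    rw [show (1 / 2 : ℂ) = ((1 / 2 : ℝ) : ℂ) by norm_num, ← Complex.ofReal_cpow Real.pi_pos.le,
      ← Complex.ofReal_mul, ← Real.rpow_add Real.pi_pos]
    norm_num
  have sqrt_two_sq : ((√2 : ℝ) : ℂ) ^ 2 = 2 := by
    exact_mod_cast Real.sq_sqrt zero_le_two
  have sq_eq : α ^ 2 = (α.re + α.im * Complex.I) ^ 2 := by rw [Complex.re_add_im]
  rw [inner_displacement_eq_integral, integral_congr_ae integrand_eq]
  simp_rw [vacuumFun_mul_displaceFun_vacuumFun]
  rw [integral_const_mul, integral_cexp_quadratic (by simp), neg_neg, div_one, ← mul_assoc,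
    normalization, one_mul, Complex.sq_norm, Complex.normSq_apply]
  push_cast
  congr 1
  linear_combination (α ^ 2 / 4) * sqrt_two_sq + sq_eq / 2 + (α.im : ℂ) ^ 2 / 2 * Complex.I_sq

@[simp]
theorem norm_vacuum : ‖vacuum‖ = 1 := by
  have norm_sq_eq_one : ((‖vacuum‖ : ℝ) : ℂ) ^ 2 = 1 := by
    simpa [inner_self_eq_norm_sq_to_K] using inner_vacuum_displacement_vacuum 0
  exact (pow_eq_one_iff_of_nonneg (norm_nonneg vacuum) two_ne_zero).mp
     (mod_cast norm_sq_eq_one)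

@[simp]
theorem norm_coherent (α : ℂ) : ‖coherent α‖ = 1 := by
  rw [coherent, norm_displacement, norm_vacuum]

theorem continuous_coherent : Continuous coherent := continuous_displacement vacuum

theorem inner_coherent_displacement_coherent (α β ξ : ℂ) :
    ⟪coherent α, displacement ξ (coherent β)⟫_ℂ =
      Complex.exp (((symp ξ β - symp α (ξ + β) : ℝ) : ℂ) * Complex.I) *
        Real.exp (-‖ξ + β - α‖ ^ 2 / 2) := by
  rw [coherent, coherent, inner_displacement_left, displacement_displacement ξ β, map_smul,
    displacement_displacement, smul_smul, inner_smul_right, ← Complex.exp_add,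
    inner_vacuum_displacement_vacuum, neg_add_eq_sub, ← add_mul, ← Complex.ofReal_add, map_neg,
    LinearMap.neg_apply, ← sub_eq_add_neg]

theorem inner_coherent_displacement_self (α ξ : ℂ) :
    ⟪coherent α, displacement ξ (coherent α)⟫_ℂ =
      Complex.exp (((2 * symp ξ α : ℝ) : ℂ) * Complex.I) * Real.exp (-‖ξ‖ ^ 2 / 2) := by
  rw [inner_coherent_displacement_coherent, add_sub_cancel_right, map_add, symp_self, add_zero,
    symp_swap α, sub_neg_eq_add, two_mul]

/-! ### Traces of mixtures -/

theorem HasTrace.unique {T : Mode →L[ℂ] Mode} {z w : ℂ} (hz : HasTrace T z) (hw : HasTrace T w) :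
    z = w := by
  obtain ⟨s, b, -⟩ := exists_hilbertBasis ℂ Mode
  exact (hz s b).unique (hw s b)

theorem HasTrace.trace_eq {T : Mode →L[ℂ] Mode} {z : ℂ} (hz : HasTrace T z) : trace T = z := by
  have exists_trace : ∃ z, HasTrace T z := ⟨z, hz⟩
  rw [trace, dif_pos exists_trace]
  exact exists_trace.choose_spec.unique hz

theorem HasTrace.add {S T : Mode →L[ℂ] Mode} {z w : ℂ} (hz : HasTrace S z) (hw : HasTrace T w) :
    HasTrace (S + T) (z + w) := by
  intro ι b
  simpa [inner_add_right] using (hz ι b).add (hw ι b)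

theorem HasTrace.smul {T : Mode →L[ℂ] Mode} {z : ℂ} (c : ℂ) (hz : HasTrace T z) :
    HasTrace (c • T) (c * z) := by
  intro ι b
  simpa [inner_smul_right] using (hz ι b).mul_left c

theorem hasTrace_zero : HasTrace 0 0 := by
  intro ι b
  simp

section InnerProductSpace

variable {𝕜 E ι : Type*} [RCLike 𝕜] [NormedAddCommGroup E] [InnerProductSpace 𝕜 E]

theorem countable_of_orthonormal [TopologicalSpace.SeparableSpace E] {e : ι → E}
    (he : Orthonormal 𝕜 e) : Countable ι := by
  have disjoint_balls : Set.univ.PairwiseDisjoint fun i => Metric.ball (e i) (1 / 2) := by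
    intro i _ j _ hij
    have dist_sq : dist (e i) (e j) ^ 2 = 2 := by
      rw [dist_eq_norm, norm_sub_sq (𝕜 := 𝕜), he.1 i, he.1 j, he.2 hij]
      norm_num
    exact Metric.ball_disjoint_ball (by nlinarith [dist_nonneg (x := e i) (y := e j)])
  exact Set.countable_univ_iff.mp (disjoint_balls.countable_of_isOpen
    (fun _ _ => Metric.isOpen_ball) fun i _ => ⟨e i, Metric.mem_ball_self (by norm_num)⟩)

theorem hasSum_norm_inner_sq (b : HilbertBasis ι 𝕜 E) (x : E) :
    HasSum (fun i => ‖inner 𝕜 (b i) x‖ ^ 2) (‖x‖ ^ 2) := by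
  have parseval := b.hasSum_inner_mul_inner x x
  simp_rw [inner_self_eq_norm_sq_to_K, ← inner_conj_symm x, RCLike.conj_mul] at parseval
  exact_mod_cast parseval

theorem exists_isPositive_mul_self_eq {H : Type*} [NormedAddCommGroup H] [InnerProductSpace ℂ H]
    [CompleteSpace H] {ρ : H →L[ℂ] H} (hρ : ρ.IsPositive) :
    ∃ r : H →L[ℂ] H, r.IsPositive ∧ r * r = ρ :=
  ⟨CFC.sqrt ρ, (ContinuousLinearMap.nonneg_iff_isPositive _).mp (CFC.sqrt_nonneg ρ),
    CFC.sqrt_mul_sqrt_self ρ ((ContinuousLinearMap.nonneg_iff_isPositive ρ).mpr hρ)⟩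

end InnerProductSpace

instance : SecondCountableTopology Mode :=
  have : Fact ((2 : ℝ≥0∞) ≠ ⊤) := ⟨ENNReal.ofNat_ne_top⟩
  inferInstance

/-- `ρ` is the weak integral `∫ |v a⟩⟨v a| dm(a)` of rank-one operators. Both the spectral
decomposition of a state and the Sudarshan–Glauber representation of a classical state are
mixtures. -/
structure IsMixture {A : Type*} [MeasurableSpace A] (m : Measure A) (v : A → Mode)
    (ρ : Mode →L[ℂ] Mode) : Prop where
  aestronglyMeasurable : AEStronglyMeasurable v m
  integrable_norm_sq : Integrable (fun a => ‖v a‖ ^ 2) m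
  inner_eq : ∀ f g : Mode, ⟪f, ρ g⟫_ℂ = ∫ a, ⟪f, v a⟫_ℂ * ⟪v a, g⟫_ℂ ∂m

section Mixture

variable {A : Type*} [MeasurableSpace A] {m : Measure A} {v : A → Mode} {ρ : Mode →L[ℂ] Mode}

theorem IsMixture.integrable_norm_apply_sq (h : IsMixture m v ρ) (B : Mode →L[ℂ] Mode) :
    Integrable (fun a => ‖B (v a)‖ ^ 2) m := by
  refine (h.integrable_norm_sq.const_mul (‖B‖ ^ 2)).mono'
    ((B.continuous.comp_aestronglyMeasurable h.aestronglyMeasurable).norm.pow 2)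
    (Filter.Eventually.of_forall fun a => ?_)
  rw [Real.norm_eq_abs, abs_of_nonneg (by positivity), ← mul_pow]
  gcongr
  exact B.le_opNorm _

theorem IsMixture.hasTrace (h : IsMixture m v ρ) (B : Mode →L[ℂ] Mode) :
    HasTrace (B ∘L ρ) (∫ a, ⟪v a, B (v a)⟫_ℂ ∂m) := by
  intro ι b
  have : Countable ι := countable_of_orthonormal b.orthonormal
  have diagonal_eq (i : ι) :
      ⟪b i, (B ∘L ρ) (b i)⟫_ℂ = ∫ a, ⟪v a, b i⟫_ℂ * ⟪b i, B (v a)⟫_ℂ ∂m := by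
    rw [ContinuousLinearMap.comp_apply, ← ContinuousLinearMap.adjoint_inner_left, h.inner_eq]
    simp_rw [ContinuousLinearMap.adjoint_inner_left, mul_comm]
  let bound (i : ι) (a : A) : ℝ := (‖⟪b i, v a⟫_ℂ‖ ^ 2 + ‖⟪b i, B (v a)⟫_ℂ‖ ^ 2) / 2
  have hasSum_bound (a : A) :
      HasSum (fun i => bound i a) ((‖v a‖ ^ 2 + ‖B (v a)‖ ^ 2) / 2) :=
    ((hasSum_norm_inner_sq b (v a)).add (hasSum_norm_inner_sq b (B (v a)))).div_const 2
  simp_rw [diagonal_eq]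
  refine hasSum_integral_of_dominated_convergence bound (fun i => ?_)
    (fun i => Filter.Eventually.of_forall fun a => ?_)
    (Filter.Eventually.of_forall fun a => (hasSum_bound a).summable) ?_
    (Filter.Eventually.of_forall fun a => b.hasSum_inner_mul_inner _ _)
  · exact (h.aestronglyMeasurable.inner aestronglyMeasurable_const).mul
      (aestronglyMeasurable_const.inner
        (B.continuous.comp_aestronglyMeasurable h.aestronglyMeasurable))
  · rw [norm_mul, norm_inner_symm]
    exact (le_div_iff₀' two_pos).mpr
      ((mul_assoc _ _ _).symm.trans_le (two_mul_le_add_sq _ _))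
  · simp_rw [fun a => (hasSum_bound a).tsum_eq]
    exact (h.integrable_norm_sq.add (h.integrable_norm_apply_sq B)).div_const 2

theorem IsMixture.trace_comp (h : IsMixture m v ρ) (B : Mode →L[ℂ] Mode) :
    trace (B ∘L ρ) = ∫ a, ⟪v a, B (v a)⟫_ℂ ∂m :=
  (h.hasTrace B).trace_eq

end Mixture

/-- Take `v i = √ρ (b i)` for a Hilbert basis `b`. -/
theorem IsDensity.exists_isMixture {ρ : Mode →L[ℂ] Mode} (hρ : IsDensity ρ) :
    ∃ (A : Type) (_ : MeasurableSpace A) (m : Measure A) (v : A → Mode),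
      SigmaFinite m ∧ IsMixture m v ρ := by
  obtain ⟨s, b, -⟩ := exists_hilbertBasis ℂ Mode
  have : Countable s := countable_of_orthonormal b.orthonormal
  obtain ⟨r, r_pos, rfl⟩ := exists_isPositive_mul_self_eq hρ.1
  have r_symm : ∀ f g, ⟪r f, g⟫_ℂ = ⟪f, r g⟫_ℂ := r_pos.isSymmetric
  have summable_norm_sq : Summable fun i => ‖r (b i)‖ ^ 2 := by
    have diagonal_eq (i : s) : ⟪b i, (r * r) (b i)⟫_ℂ = ((‖r (b i)‖ ^ 2 : ℝ) : ℂ) := by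
      rw [mul_apply_eq_comp, ← r_symm, inner_self_eq_norm_sq_to_K]
      norm_cast
    exact Complex.summable_ofReal.mp ((hρ.2 s b).summable.congr diagonal_eq)
  let : MeasurableSpace s := ⊤
  refine ⟨s, ⊤, Measure.count, fun i => r (b i), inferInstance,
    StronglyMeasurable.of_discrete.aestronglyMeasurable,
    integrable_count_iff.mpr summable_norm_sq.norm, fun f g => ?_⟩
  have hasSum_inner : HasSum (fun i => ⟪f, r (b i)⟫_ℂ * ⟪r (b i), g⟫_ℂ) ⟪f, (r * r) g⟫_ℂ := by
    simp_rw [mul_apply_eq_comp, ← r_symm f, r_symm _ g]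
    exact b.hasSum_inner_mul_inner _ _
  rw [integral_countable (integrable_count_iff.mpr hasSum_inner.summable.norm)]
  simpa using hasSum_inner.tsum_eq.symm

theorem exists_hasTrace_comp (B : Mode →L[ℂ] Mode) (T : traceClass) :
    ∃ z, HasTrace (B ∘L (T : Mode →L[ℂ] Mode)) z := by
  obtain ⟨T, hT⟩ := T
  induction hT using Submodule.span_induction with
  | mem ρ hρ =>
    obtain ⟨A, _, m, v, -, mixture⟩ := IsDensity.exists_isMixture hρ
    exact ⟨_, mixture.hasTrace B⟩
  | zero => exact ⟨0, by simpa using hasTrace_zero⟩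
  | add S T _ _ hS hT =>
    obtain ⟨z, hz⟩ := hS
    obtain ⟨w, hw⟩ := hT
    exact ⟨z + w, by simpa using hz.add hw⟩
  | smul c T _ hT =>
    obtain ⟨z, hz⟩ := hT
    exact ⟨c * z, by simpa using hz.smul c⟩

theorem hasTrace_comp (B : Mode →L[ℂ] Mode) (T : traceClass) :
    HasTrace (B ∘L (T : Mode →L[ℂ] Mode)) (trace (B ∘L (T : Mode →L[ℂ] Mode))) := by
  obtain ⟨z, hz⟩ := exists_hasTrace_comp B T
  rwa [hz.trace_eq]

theorem hasTrace_comp_rankOne (B : Mode →L[ℂ] Mode) (u w : Mode) :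
    HasTrace (B ∘L InnerProductSpace.rankOne ℂ u w) ⟪w, B u⟫_ℂ := by
  intro ι b
  simpa [inner_smul_right] using b.hasSum_inner_mul_inner w (B u)

theorem isDensity_rankOne_self {u : Mode} (hu : ‖u‖ = 1) :
    IsDensity (InnerProductSpace.rankOne ℂ u u) := by
  refine ⟨InnerProductSpace.isPositive_rankOne_self u, ?_⟩
  simpa [inner_self_eq_norm_sq_to_K, hu] using
    hasTrace_comp_rankOne (ContinuousLinearMap.id ℂ Mode) u u

theorem rankOne_self_mem_traceClass (u : Mode) :
    InnerProductSpace.rankOne ℂ u u ∈ traceClass := by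
  rcases eq_or_ne u 0 with rfl | hu
  · simp
  · obtain ⟨c, e, he, rfl⟩ : ∃ (c : ℂ) (e : Mode), ‖e‖ = 1 ∧ u = c • e :=
      ⟨‖u‖, (‖u‖ : ℂ)⁻¹ • u, norm_smul_inv_norm hu, by rw [smul_inv_smul₀ (by simpa using hu)]⟩
    rw [map_smulₛₗ, map_smulₛₗ, _root_.smul_apply]
    exact Submodule.smul_mem _ _ (Submodule.smul_mem _ _
      (Submodule.subset_span (isDensity_rankOne_self he)))

theorem rankOne_polarization (u w : Mode) :
    InnerProductSpace.rankOne ℂ u w = (1 / 4 : ℂ) •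
      (InnerProductSpace.rankOne ℂ (u + w) (u + w) - InnerProductSpace.rankOne ℂ (u - w) (u - w)
      + Complex.I •
        InnerProductSpace.rankOne ℂ (u + Complex.I • w) (u + Complex.I • w)
      - Complex.I •
        InnerProductSpace.rankOne ℂ (u - Complex.I • w) (u - Complex.I • w)) := by
  simp only [map_add, map_sub, map_smul, map_smulₛₗ, _root_.add_apply, _root_.sub_apply,
    _root_.smul_apply, Complex.conj_I]
  match_scalars <;> ring_nf <;> norm_num [Complex.I_sq]

theorem rankOne_mem_traceClass (u w : Mode) : InnerProductSpace.rankOne ℂ u w ∈ traceClass := by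
  rw [rankOne_polarization]
  have mem := rankOne_self_mem_traceClass
  exact Submodule.smul_mem _ _ (Submodule.sub_mem _ (Submodule.add_mem _ (Submodule.sub_mem _
    (mem _) (mem _)) (Submodule.smul_mem _ _ (mem _))) (Submodule.smul_mem _ _ (mem _)))

/-! ### Reconstruction of an operator from its characteristic function -/

theorem continuous_displacement_uncurry :
    Continuous fun p : ℂ × Mode => displacement p.1 p.2 := by
  rw [continuous_iff_continuousAt]
  rintro ⟨α, ψ⟩
  rw [ContinuousAt, tendsto_iff_norm_sub_tendsto_zero]
  have continuous_bound : Continuous fun p : ℂ × Mode =>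
      ‖p.2 - ψ‖ + ‖displacement p.1 ψ - displacement α ψ‖ :=
    (continuous_snd.sub continuous_const).norm.add
      (((continuous_displacement ψ).comp continuous_fst).sub continuous_const).norm
  refine squeeze_zero (fun _ => norm_nonneg _) (fun p => ?_)
    (by simpa using continuous_bound.tendsto (α, ψ))
  rw [← norm_displacement p.1 (p.2 - ψ), map_sub]
  exact norm_sub_le_norm_sub_add_norm_sub _ _ _

theorem continuous_inner_displacement (u w : Mode) :
    Continuous fun ξ : ℂ => ⟪u, displacement ξ w⟫_ℂ :=
  continuous_const.inner (continuous_displacement w)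

theorem norm_inner_displacement_le (u w : Mode) (ξ : ℂ) :
    ‖⟪u, displacement ξ w⟫_ℂ‖ ≤ ‖u‖ * ‖w‖ := by
  simpa using norm_inner_le_norm (𝕜 := ℂ) u (displacement ξ w)

section Gaussian

variable {V : Type*} [NormedAddCommGroup V] [InnerProductSpace ℝ V] [FiniteDimensional ℝ V]
  [MeasurableSpace V] [BorelSpace V]

theorem integrable_exp_neg_mul_norm_sq {c : ℝ} (hc : 0 < c) :
    Integrable fun v : V => Real.exp (-c * ‖v‖ ^ 2) := by
  refine (GaussianFourier.integrable_cexp_neg_mul_sq_norm_add (V := V) (b := c)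
    (by simpa using hc) 0 0).norm.congr (Filter.Eventually.of_forall fun v => ?_)
  simp only [zero_mul, add_zero, Complex.norm_exp]
  norm_cast

theorem integrable_exp_neg_norm_sq_div_two : Integrable fun v : V => Real.exp (-‖v‖ ^ 2 / 2) := by
  convert integrable_exp_neg_mul_norm_sq (V := V) one_half_pos using 3
  ring

end Gaussian

theorem integrable_gauss_mul_inner (u w : Mode) :
    Integrable fun ξ : ℂ => (Real.exp (-‖ξ‖ ^ 2 / 2) : ℂ) * ⟪u, displacement ξ w⟫_ℂ :=
  integrable_exp_neg_norm_sq_div_two.ofReal.mul_bdd (c := ‖u‖ * ‖w‖)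
    (continuous_inner_displacement u w).aestronglyMeasurable
    (Filter.Eventually.of_forall fun ξ => norm_inner_displacement_le u w ξ)

theorem integral_gauss_mul_cexp (t : ℝ) :
    ∫ b : ℝ, (Real.exp (-b ^ 2 / 2) : ℂ) * Complex.exp ((t * b : ℝ) * Complex.I) =
      √(2 * Real.pi) * Real.exp (-t ^ 2 / 2) := by
  have fourier := fourierIntegral_gaussian (b := 1 / 2) (by norm_num) t
  convert fourier using 1
  · congr 1 with b
    rw [mul_comm, Complex.ofReal_exp]
    congr 2 <;> push_cast <;> ring
  · rw [Real.sqrt_eq_rpow, Complex.ofReal_cpow (by positivity)]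
    congr 2 <;> push_cast <;> ring_nf

theorem integrable_conj_mul_comp_sub (u w : Mode) (a : ℝ) :
    Integrable fun x : ℝ => starRingEnd ℂ (u x) * w (x - √2 * a) := by
  refine (L2.integrable_inner (𝕜 := ℂ) u (displacement a w)).congr ?_
  filter_upwards [displacement_coeFn a w] with x hx
  rw [hx, RCLike.inner_apply, mul_comm]
  simp [displaceFun]

theorem integral_gauss_mul_inner_im (u w : Mode) (a : ℝ) :
    ∫ b : ℝ, (Real.exp (-b ^ 2 / 2) : ℂ) * ⟪u, displacement ⟨a, b⟩ w⟫_ℂ =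
      √(2 * Real.pi) * ∫ x : ℝ, (Real.exp (-(√2 * x - a) ^ 2 / 2) : ℂ) *
        (starRingEnd ℂ (u x) * w (x - √2 * a)) := by
  let overlap (x : ℝ) : ℂ := starRingEnd ℂ (u x) * w (x - √2 * a)
  let wave (b x : ℝ) : ℂ :=
    (Real.exp (-b ^ 2 / 2) : ℂ) * Complex.exp (((√2 * x - a) * b : ℝ) * Complex.I)
  have integrable_wave_mul :
      Integrable (fun p : ℝ × ℝ => wave p.1 p.2 * overlap p.2) (volume.prod volume) := by
    have gauss_mul_overlap := (integrable_exp_neg_norm_sq_div_two (V := ℝ)).ofReal.mul_prod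
      (integrable_conj_mul_comp_sub u w a)
    refine (gauss_mul_overlap.mul_bdd (c := 1)
      (g := fun p : ℝ × ℝ => Complex.exp (((√2 * p.2 - a) * p.1 : ℝ) * Complex.I))
      (Continuous.aestronglyMeasurable (by fun_prop))
      (Filter.Eventually.of_forall fun p => (Complex.norm_exp_ofReal_mul_I _).le)).congr
      (Filter.Eventually.of_forall fun p => ?_)
    simp only [wave, overlap, Real.norm_eq_abs, sq_abs]
    exact mul_right_comm _ _ _
  have expand (b : ℝ) : (Real.exp (-b ^ 2 / 2) : ℂ) * ⟪u, displacement ⟨a, b⟩ w⟫_ℂ =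
      ∫ x : ℝ, wave b x * overlap x := by
    rw [inner_displacement_eq_integral, ← integral_const_mul]
    congr 1 with x
    simp only [displaceFun, wave, overlap]
    ring_nf
  simp_rw [expand]
  rw [integral_integral_swap integrable_wave_mul, ← integral_const_mul]
  congr 1 with x
  rw [integral_mul_const, integral_gauss_mul_cexp, mul_assoc]

theorem integral_integral_mul_comp_sub {f g : ℝ → ℂ} (hf : Integrable f) (hg : Integrable g)
    {c : ℝ} (hc : 0 < c) :
    ∫ a, ∫ x, f x * g (x - c * a) = (c : ℂ)⁻¹ * ((∫ x, f x) * ∫ x, g x) := by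
  have convolution := integral_convolution (ContinuousLinearMap.mul ℝ ℂ) hf hg.comp_neg
  simp only [MeasureTheory.convolution_def, neg_sub, ContinuousLinearMap.mul_apply'] at convolution
  rw [integral_neg_eq_self] at convolution
  rw [Measure.integral_comp_mul_left (fun y => ∫ x, f x * g (x - y)), convolution,
    abs_of_pos (inv_pos.mpr hc), Complex.real_smul, Complex.ofReal_inv]

theorem gauss_mul_gauss_eq_vacuumFun_mul (a x : ℝ) :
    (Real.exp (-a ^ 2 / 2) : ℂ) * Real.exp (-(√2 * x - a) ^ 2 / 2) =
      √Real.pi * (vacuumFun x * vacuumFun (x - √2 * a)) := by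
  have sqrt_two_mul_self : √2 * √2 = (2 : ℝ) := Real.mul_self_sqrt zero_le_two
  have normalization : √Real.pi * (Real.pi ^ (-(1 / 4) : ℝ) * Real.pi ^ (-(1 / 4) : ℝ)) = 1 := by
    rw [Real.sqrt_eq_rpow, ← Real.rpow_add Real.pi_pos, ← Real.rpow_add Real.pi_pos]
    norm_num
  have gauss_eq : Real.exp (-a ^ 2 / 2) * Real.exp (-(√2 * x - a) ^ 2 / 2) =
      Real.exp (-x ^ 2 / 2) * Real.exp (-(x - √2 * a) ^ 2 / 2) := by
    rw [← Real.exp_add, ← Real.exp_add]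
    congr 1
    linear_combination (-(x ^ 2 / 2) + a ^ 2 / 2) * sqrt_two_mul_self
  simp only [vacuumFun]
  norm_cast
  linear_combination gauss_eq - (Real.exp (-x ^ 2 / 2) * Real.exp (-(x - √2 * a) ^ 2 / 2)) *
    normalization

theorem integral_gauss_mul_inner_mk (u w : Mode) (a : ℝ) :
    ∫ b : ℝ, (Real.exp (-‖(⟨a, b⟩ : ℂ)‖ ^ 2 / 2) : ℂ) * ⟪u, displacement ⟨a, b⟩ w⟫_ℂ =
      (√(2 * Real.pi) * √Real.pi : ℂ) * ∫ x, (starRingEnd ℂ (u x) * vacuumFun x) *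
        (vacuumFun (x - √2 * a) * w (x - √2 * a)) := by
  have gauss_split (b : ℝ) : (Real.exp (-‖(⟨a, b⟩ : ℂ)‖ ^ 2 / 2) : ℂ) =
      Real.exp (-a ^ 2 / 2) * Real.exp (-b ^ 2 / 2) := by
    rw [← Complex.ofReal_mul, ← Real.exp_add, Complex.sq_norm, Complex.normSq_mk]
    congr 2
    ring
  simp_rw [gauss_split, mul_assoc, integral_const_mul, integral_gauss_mul_inner_im]
  rw [mul_left_comm]
  simp_rw [← integral_const_mul]
  congr 2
  ext x
  linear_combination (√(2 * Real.pi) * starRingEnd ℂ (u x) * w (x - √2 * a)) *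
    gauss_mul_gauss_eq_vacuumFun_mul a x

/-- The Gaussian superposition of all displacement operators is `π |0⟩⟨0|`. -/
theorem integral_gauss_mul_inner (u w : Mode) :
    ∫ ξ : ℂ, (Real.exp (-‖ξ‖ ^ 2 / 2) : ℂ) * ⟪u, displacement ξ w⟫_ℂ =
      Real.pi * (⟪u, vacuum⟫_ℂ * ⟪vacuum, w⟫_ℂ) := by
  have mp := Complex.volume_preserving_equiv_real_prod.symm
  have emb := Complex.measurableEquivRealProd.symm.measurableEmbedding
  have left_eq : (fun x => ⟪u x, vacuum x⟫_ℂ) =ᵐ[volume]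
      fun x => starRingEnd ℂ (u x) * vacuumFun x := by
    filter_upwards [vacuum_coeFn] with x hx
    rw [hx, RCLike.inner_apply, mul_comm]
  have right_eq : (fun x => ⟪vacuum x, w x⟫_ℂ) =ᵐ[volume] fun x => vacuumFun x * w x := by
    filter_upwards [vacuum_coeFn] with x hx
    rw [hx, RCLike.inner_apply, mul_comm, vacuumFun, Complex.conj_ofReal]
  rw [← mp.integral_comp emb, Measure.volume_eq_prod]
  refine (integral_prod _ ((mp.integrable_comp_emb emb).mpr
    (integrable_gauss_mul_inner u w))).trans ?_
  refine (integral_congr_ae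
    (Filter.Eventually.of_forall (integral_gauss_mul_inner_mk u w))).trans ?_
  rw [integral_const_mul, integral_integral_mul_comp_sub
    (g := fun y => vacuumFun y * w y)
    ((L2.integrable_inner u vacuum).congr left_eq) ((L2.integrable_inner vacuum w).congr right_eq)
    (Real.sqrt_pos.mpr two_pos), L2.inner_def, L2.inner_def, integral_congr_ae left_eq,
    integral_congr_ae right_eq, ← mul_assoc]
  congr 1
  norm_cast
  rw [Real.sqrt_mul zero_le_two]
  field_simp
  exact Real.sq_sqrt Real.pi_pos.le

theorem displacement_displacement_displacement_neg (β ξ : ℂ) (ψ : Mode) :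
    displacement β (displacement ξ (displacement (-β) ψ)) =
      Complex.exp ((2 * symp β ξ : ℝ) * Complex.I) • displacement ξ ψ := by
  rw [displacement_displacement ξ, map_smul, displacement_displacement, smul_smul,
    ← Complex.exp_add, ← add_mul, add_neg_cancel_comm_assoc, ← Complex.ofReal_add, map_neg, map_add,
    map_neg, symp_self, neg_zero, add_zero, symp_swap ξ, neg_neg, ← two_mul]

/-- The Gaussian-weighted function `ξ ↦ ⟨f, D(ξ) f⟩` has Fourier transform
`|⟨f, β⟩|²` up to scaling, so it vanishes when `f` is orthogonal to all coherent states. -/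
theorem eq_zero_of_inner_coherent {f : Mode} (orthogonal : ∀ β, ⟪f, coherent β⟫_ℂ = 0) :
    f = 0 := by
  let g : ℂ → ℂ := fun ξ => (Real.exp (-‖ξ‖ ^ 2 / 2) : ℂ) * ⟪f, displacement ξ f⟫_ℂ
  have continuous_g : Continuous g := by
    exact Continuous.mul (by fun_prop) (continuous_inner_displacement f f)
  have fourier_eq_zero : FourierTransform.fourier g = 0 := by
    ext1 w
    let β : ℂ := ⟨Real.pi * w.im, -(Real.pi * w.re)⟩
    have superposition := integral_gauss_mul_inner (displacement (-β) f) (displacement (-β) f)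
    have inner_eq_zero : ⟪f, displacement β vacuum⟫_ℂ = 0 := orthogonal β
    rw [inner_displacement_left (-β) f vacuum, neg_neg, inner_eq_zero, zero_mul,
      mul_zero] at superposition
    rw [Real.fourier_eq', Pi.zero_apply, ← superposition]
    congr 1 with ξ
    have phase_eq : -2 * Real.pi * ⟪ξ, w⟫_ℝ = 2 * symp β ξ := by
      simp only [Complex.inner, Complex.mul_re, Complex.conj_re, Complex.conj_im, symp_apply, β]
      ring
    rw [inner_displacement_left, neg_neg, displacement_displacement_displacement_neg,
      inner_smul_right, smul_eq_mul, phase_eq, mul_left_comm]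
  have inversion := congrFun (continuous_g.fourierInv_fourier_eq (integrable_gauss_mul_inner f f)
    (by rw [fourier_eq_zero]; exact integrable_zero _ _ _)) 0
  rw [fourier_eq_zero, Real.fourierInv_eq'] at inversion
  simpa [g] using inversion.symm

theorem ext_inner_coherent {S T : Mode →L[ℂ] Mode}
    (h : ∀ β γ, ⟪coherent β, S (coherent γ)⟫_ℂ = ⟪coherent β, T (coherent γ)⟫_ℂ) : S = T := by
  have apply_coherent (γ : ℂ) : (S - T) (coherent γ) = 0 :=
    eq_zero_of_inner_coherent fun β => by
      rw [← inner_conj_symm, _root_.sub_apply, inner_sub_right, h, sub_self, map_zero]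
  have adjoint_eq_zero : ContinuousLinearMap.adjoint (S - T) = 0 := by
    ext1 f
    exact eq_zero_of_inner_coherent fun γ => by
      rw [ContinuousLinearMap.adjoint_inner_left, apply_coherent, inner_zero_right]
  exact sub_eq_zero.mp ((LinearIsometryEquiv.map_eq_zero_iff _).mp adjoint_eq_zero)

theorem inner_coherent_mul_inner_coherent (β γ : ℂ) (u : Mode) :
    ⟪coherent β, u⟫_ℂ * ⟪u, coherent γ⟫_ℂ = (Real.pi : ℂ)⁻¹ *
      ∫ ξ : ℂ, (Real.exp (-‖ξ‖ ^ 2 / 2) : ℂ) *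
        (Complex.exp ((symp ξ (-β) + symp γ (ξ - β) : ℝ) * Complex.I) *
          ⟪u, displacement (γ + (ξ - β)) u⟫_ℂ) := by
  have superposition := integral_gauss_mul_inner (displacement (-γ) u) (displacement (-β) u)
  rw [inner_displacement_left (-γ) u, neg_neg, ← inner_displacement_left β vacuum] at superposition
  rw [eq_inv_mul_iff_mul_eq₀ (mod_cast Real.pi_ne_zero), mul_comm ⟪coherent β, u⟫_ℂ]
  refine superposition.symm.trans ?_
  congr 1 with ξ
  rw [inner_displacement_left, neg_neg, displacement_displacement ξ, map_smul,
    displacement_displacement, smul_smul, inner_smul_right, ← Complex.exp_add, ← add_mul,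
    ← Complex.ofReal_add, ← sub_eq_add_neg]

section Mixture

variable {A : Type*} [MeasurableSpace A] {m : Measure A} {v : A → Mode} {ρ : Mode →L[ℂ] Mode}

theorem IsMixture.inner_coherent [SFinite m] (h : IsMixture m v ρ) (β γ : ℂ) :
    ⟪coherent β, ρ (coherent γ)⟫_ℂ = (Real.pi : ℂ)⁻¹ *
      ∫ ξ : ℂ, (Real.exp (-‖ξ‖ ^ 2 / 2) : ℂ) *
        (Complex.exp ((symp ξ (-β) + symp γ (ξ - β) : ℝ) * Complex.I) *
          trace (displacement (γ + (ξ - β)) ∘L ρ)) := by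
  simp_rw [h.inner_eq, h.trace_comp, inner_coherent_mul_inner_coherent, integral_const_mul]
  rw [integral_integral_swap]
  · simp_rw [integral_const_mul]
  refine (h.integrable_norm_sq.mul_prod integrable_exp_neg_norm_sq_div_two).mono ?_
    (Filter.Eventually.of_forall fun p => ?_)
  · have measurable_v : AEStronglyMeasurable (fun p : A × ℂ => v p.1) (m.prod volume) :=
      h.aestronglyMeasurable.comp_fst
    have measurable_displacement :=
      continuous_displacement_uncurry.comp_aestronglyMeasurable
        (AEStronglyMeasurable.prodMk (f := fun p : A × ℂ => γ + (p.2 - β))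
          (Measurable.aestronglyMeasurable (by fun_prop)) measurable_v)
    have continuous_phase : Continuous fun ξ : ℂ =>
        Complex.exp ((symp ξ (-β) + symp γ (ξ - β) : ℝ) * Complex.I) := by
      simp only [symp_apply]
      fun_prop
    exact AEStronglyMeasurable.mul (Measurable.aestronglyMeasurable (by fun_prop))
      ((continuous_phase.comp_aestronglyMeasurable aestronglyMeasurable_id.comp_snd).mul
        (measurable_v.inner measurable_displacement))
  · simp only [Function.uncurry, norm_mul, Complex.norm_exp_ofReal_mul_I, one_mul,
      Complex.norm_real, Real.norm_eq_abs, Real.abs_exp]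
    rw [abs_of_nonneg (by positivity), mul_comm]
    gcongr
    simpa [sq] using norm_inner_displacement_le (v p.1) (v p.1) _

theorem IsMixture.ext_trace {B : Type*} [MeasurableSpace B] {n : Measure B} {w : B → Mode}
    {σ : Mode →L[ℂ] Mode} [SFinite m] [SFinite n] (hρ : IsMixture m v ρ) (hσ : IsMixture n w σ)
    (trace_eq : ∀ ξ, trace (displacement ξ ∘L ρ) = trace (displacement ξ ∘L σ)) : ρ = σ :=
  ext_inner_coherent fun β γ => by
    simp_rw [hρ.inner_coherent, hσ.inner_coherent, trace_eq]

end Mixture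

theorem isMixture_coherent_integral (μ : Measure ℂ) [IsFiniteMeasure μ] :
    IsMixture μ coherent (∫ α, InnerProductSpace.rankOne ℂ (coherent α) (coherent α) ∂μ) := by
  have integrable_rankOne :
      Integrable (fun α => InnerProductSpace.rankOne ℂ (coherent α) (coherent α)) μ := by
    refine Integrable.of_bound (C := 1) ?_ (Filter.Eventually.of_forall fun α => ?_)
    · exact (isBoundedBilinearMap_smulRight.continuous.comp₂
        ((innerSL ℂ).continuous.comp continuous_coherent)
        continuous_coherent).aestronglyMeasurable
    · simp
  refine ⟨continuous_coherent.aestronglyMeasurable, by simp, fun f g => ?_⟩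
  rw [ContinuousLinearMap.integral_apply integrable_rankOne,
    ← integral_inner (integrable_rankOne.apply_continuousLinearMap g)]
  simp_rw [InnerProductSpace.rankOne_apply, inner_smul_right, mul_comm]

theorem isClassical_iff_exists_isMixture {ρ : Mode →L[ℂ] Mode} :
    IsClassical ρ ↔ ∃ μ : Measure ℂ, IsProbabilityMeasure μ ∧ IsMixture μ coherent ρ := by
  refine exists_congr fun μ => and_congr_right fun _ => ⟨fun h => ?_, fun h => h.inner_eq⟩
  exact ⟨continuous_coherent.aestronglyMeasurable, by simp, h⟩

theorem IsMixture.isClassical_of_trace_eq {A : Type*} [MeasurableSpace A] {m : Measure A}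
    [SFinite m] {v : A → Mode} {ρ : Mode →L[ℂ] Mode} (hρ : IsMixture m v ρ) (μ : Measure ℂ)
    [IsProbabilityMeasure μ]
    (trace_eq : ∀ ξ, trace (displacement ξ ∘L ρ) =
      ∫ α, ⟪coherent α, displacement ξ (coherent α)⟫_ℂ ∂μ) : IsClassical ρ := by
  have hμ := isMixture_coherent_integral μ
  have eq_integral := hρ.ext_trace hμ fun ξ => by rw [trace_eq, hμ.trace_comp]
  exact isClassical_iff_exists_isMixture.mpr ⟨μ, inferInstance, eq_integral ▸ hμ⟩

/-! ### Bochner's theorem -/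

/-- A positive definite function on an additive group: the kernel `(x, y) ↦ φ (x - y)` is positive
semidefinite on every finite family of points. -/
def IsPosDefFun {V : Type*} [AddGroup V] (φ : V → ℂ) : Prop :=
  ∀ (n : ℕ) (x : Fin n → V), (Matrix.of fun i j => φ (x i - x j)).PosSemidef

namespace IsPosDefFun

variable {V : Type*} [AddGroup V] {φ : V → ℂ}

theorem sum_nonneg (h : IsPosDefFun φ) (n : ℕ) (x : Fin n → V) :
    0 ≤ ∑ i, ∑ j, φ (x i - x j) := by
  simpa [dotProduct, mulVec] using (h n x).dotProduct_mulVec_nonneg fun _ => 1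

theorem map_neg (h : IsPosDefFun φ) (t : V) : φ (-t) = starRingEnd ℂ (φ t) := by
  simpa using ((h 2 ![t, 0]).isHermitian.apply 1 0).symm

theorem norm_le (h : IsPosDefFun φ) (t : V) : ‖φ t‖ ≤ ‖φ 0‖ := by
  have zero_eq_norm : φ 0 = ‖φ 0‖ :=
    Complex.eq_coe_norm_of_nonneg (by simpa using (h 1 ![0]).diag_nonneg (i := 0))
  have det_nonneg := (h 2 ![t, 0]).det_nonneg
  simp only [det_fin_two, of_apply, cons_val_zero, cons_val_one, sub_self, sub_zero, zero_sub,
    h.map_neg, Complex.mul_conj', sub_nonneg] at det_nonneg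
  rw [zero_eq_norm, ← sq] at det_nonneg
  exact (sq_le_sq₀ (norm_nonneg _) (norm_nonneg _)).mp (by exact_mod_cast det_nonneg)

theorem mul {ψ : V → ℂ} (h : IsPosDefFun φ) (hψ : IsPosDefFun ψ) :
    IsPosDefFun fun x => φ x * ψ x :=
  fun n x => (h n x).hadamard (hψ n x)

theorem comp {W : Type*} [AddGroup W] (h : IsPosDefFun φ) (f : W →+ V) : IsPosDefFun (φ ∘ f) := by
  intro n x
  simpa using h n (f ∘ x)

theorem mul_const {c : ℂ} (h : IsPosDefFun φ) (hc : 0 ≤ c) : IsPosDefFun fun x => φ x * c := by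
  intro n x
  refine (congrArg Matrix.PosSemidef ?_).mp ((h n x).smul hc)
  ext i j
  simp [mul_comm c]

end IsPosDefFun

theorem isPosDefFun_cexp_mul_I {V : Type*} [AddGroup V] (f : V →+ ℝ) :
    IsPosDefFun fun x => Complex.exp (f x * Complex.I) := by
  intro n x
  refine (congrArg Matrix.PosSemidef ?_).mp
    (posSemidef_vecMulVec_self_star fun i => Complex.exp (f (x i) * Complex.I))
  ext i j
  simp only [vecMulVec_apply, Pi.star_apply, RCLike.star_def, ← Complex.exp_conj, map_mul,
    Complex.conj_ofReal, Complex.conj_I, ← Complex.exp_add, of_apply, map_sub,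
    Complex.ofReal_sub]
  ring_nf

section Sampling

variable {V : Type*} [MeasurableSpace V] {ν : Measure V} [IsProbabilityMeasure ν] {k : V → V → ℂ}

theorem measurePreserving_infinitePi_eval_prod {i j : ℕ} (hij : i ≠ j) :
    MeasurePreserving (fun x : ℕ → V => (x i, x j)) (Measure.infinitePi fun _ => ν)
      (ν.prod ν) :=
  ⟨by fun_prop, Measure.infinitePi_map_eval_prod hij⟩

theorem integrable_infinitePi_kernel (hk : Integrable (Function.uncurry k) (ν.prod ν))
    (hdiag : Integrable (fun x => k x x) ν) (i j : ℕ) :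
    Integrable (fun x : ℕ → V => k (x i) (x j)) (Measure.infinitePi fun _ => ν) := by
  obtain rfl | hij := eq_or_ne i j
  · exact (measurePreserving_eval_infinitePi (fun _ => ν) i).integrable_comp_of_integrable hdiag
  · exact (measurePreserving_infinitePi_eval_prod hij).integrable_comp_of_integrable hk

theorem integral_infinitePi_kernel (hk : Integrable (Function.uncurry k) (ν.prod ν))
    (hdiag : Integrable (fun x => k x x) ν) (i j : ℕ) :
    ∫ x : ℕ → V, k (x i) (x j) ∂Measure.infinitePi (fun _ => ν) =
      if i = j then ∫ x, k x x ∂ν else ∫ x, ∫ y, k x y ∂ν ∂ν := by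
  split_ifs with hij
  · subst hij
    have eval := measurePreserving_eval_infinitePi (fun _ : ℕ => ν) i
    rw [← eval.map_eq] at hdiag
    conv_rhs => rw [← eval.map_eq]
    exact (integral_map eval.measurable.aemeasurable hdiag.aestronglyMeasurable).symm
  · have eval := measurePreserving_infinitePi_eval_prod (ν := ν) hij
    refine Eq.trans ?_ (integral_prod _ hk)
    rw [← eval.map_eq] at hk ⊢
    exact (integral_map eval.measurable.aemeasurable hk.aestronglyMeasurable).symm

/-- Evaluate the kernel on `n` independent samples of `ν`: the mean of the double sum is
`n (n - 1) ∫∫ k + n ∫ k(x, x)`, and the first term dominates as `n → ∞`. -/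
theorem integral_integral_nonneg_of_sum_nonneg (hk : Integrable (Function.uncurry k) (ν.prod ν))
    (hdiag : Integrable (fun x => k x x) ν)
    (hpos : ∀ (n : ℕ) (x : Fin n → V), 0 ≤ ∑ i, ∑ j, k (x i) (x j)) :
    0 ≤ ∫ x, ∫ y, k x y ∂ν ∂ν := by
  set z := ∫ x, ∫ y, k x y ∂ν ∂ν
  set d := ∫ x, k x x ∂ν
  have mean_nonneg (n : ℕ) : 0 ≤ (n : ℂ) * ((n : ℂ) - 1) * z + n * d := by
    have mean_eq : ∫ x : ℕ → V, ∑ i : Fin n, ∑ j : Fin n, k (x i) (x j)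
        ∂Measure.infinitePi (fun _ => ν) = ∑ i : Fin n, ∑ j : Fin n, if i = j then d else z := by
      have integrable_kernel (i j : Fin n) := integrable_infinitePi_kernel hk hdiag i j
      simp_rw [integral_finsetSum _ fun _ _ => integrable_finsetSum _ fun _ _ =>
        integrable_kernel _ _, integral_finsetSum _ fun _ _ => integrable_kernel _ _,
        integral_infinitePi_kernel hk hdiag, z, d, Fin.val_inj]
    have ite_eq (i j : Fin n) : (if i = j then d else z) = z + if i = j then d - z else 0 := by
      split_ifs <;> ring
    refine (integral_nonneg fun x : ℕ → V => hpos n fun i => x i).trans_eq (mean_eq.trans ?_)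
    simp only [ite_eq, Finset.sum_add_distrib, Finset.sum_ite_eq, Finset.mem_univ, if_true,
      Finset.sum_const, Finset.card_univ, Fintype.card_fin, nsmul_eq_mul]
    ring
  have tendsto_mean : Filter.Tendsto (fun n : ℕ => z + (1 / ((n : ℂ) + 1)) * d) Filter.atTop
      (nhds z) := by
    simpa using (tendsto_one_div_add_atTop_nhds_zero_nat (𝕜 := ℂ)).mul_const d |>.const_add z
  refine ge_of_tendsto' tendsto_mean fun n => ?_
  have weight_nonneg : (0 : ℂ) ≤ (((((n : ℝ) + 2) * ((n : ℝ) + 1))⁻¹ : ℝ) : ℂ) :=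
    Complex.zero_le_real.mpr (by positivity)
  have succ_ne_zero : (n : ℂ) + 1 ≠ 0 := by exact_mod_cast n.succ_ne_zero
  have succ_succ_ne_zero : (n : ℂ) + 2 ≠ 0 := by exact_mod_cast (n + 1).succ_ne_zero
  refine (mul_nonneg weight_nonneg (mean_nonneg (n + 2))).trans_eq ?_
  push_cast
  field_simp
  ring

end Sampling

section GaussianDamping

variable {V : Type*} [NormedAddCommGroup V] {φ : V → ℂ} {c C : ℝ}

/-- The product of `φ` with the Gaussian `exp (-c ‖u‖²)`, which makes a bounded function
integrable. -/
noncomputable def gaussDamp (c : ℝ) (φ : V → ℂ) (u : V) : ℂ :=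
  (Real.exp (-c * ‖u‖ ^ 2) : ℂ) * φ u

theorem gaussDamp_zero_right (c : ℝ) (φ : V → ℂ) : gaussDamp c φ 0 = φ 0 := by
  simp [gaussDamp]

theorem continuous_gaussDamp (hφ : Continuous φ) : Continuous (gaussDamp c φ) := by
  unfold gaussDamp
  fun_prop

theorem norm_gaussDamp_le (hc : 0 ≤ c) (hφ : ∀ u, ‖φ u‖ ≤ C) (u : V) :
    ‖gaussDamp c φ u‖ ≤ C := by
  rw [gaussDamp, norm_mul, Complex.norm_real, Real.norm_of_nonneg (Real.exp_nonneg _)]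
  refine (mul_le_of_le_one_left (norm_nonneg _) (Real.exp_le_one_iff.mpr ?_)).trans (hφ u)
  nlinarith [sq_nonneg ‖u‖]

theorem norm_gaussDamp_of_nonneg (hφ : ∀ w, 0 ≤ φ w) (w : V) :
    (‖gaussDamp c φ w‖ : ℂ) = gaussDamp c φ w :=
  (Complex.eq_coe_norm_of_nonneg
    (mul_nonneg (Complex.zero_le_real.mpr (Real.exp_nonneg _)) (hφ w))).symm

theorem tendsto_gaussDamp (φ : V → ℂ) (u : V) :
    Filter.Tendsto (fun n : ℕ => gaussDamp (1 / ((n : ℝ) + 1)) φ u) Filter.atTop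
      (nhds (φ u)) := by
  have exp_tendsto : Filter.Tendsto (fun n : ℕ => Real.exp (-(1 / ((n : ℝ) + 1)) * ‖u‖ ^ 2))
      Filter.atTop (nhds (Real.exp (-0 * ‖u‖ ^ 2))) :=
    (Real.continuous_exp.tendsto _).comp
      (tendsto_one_div_add_atTop_nhds_zero_nat.neg.mul_const _)
  simpa [gaussDamp] using ((Complex.continuous_ofReal.tendsto _).comp exp_tendsto).mul_const (φ u)

variable [InnerProductSpace ℝ V] [FiniteDimensional ℝ V] [MeasurableSpace V] [BorelSpace V]

theorem integrable_gaussDamp (hφ : Continuous φ) (hC : ∀ u, ‖φ u‖ ≤ C) (hc : 0 < c) :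
    Integrable (gaussDamp c φ) :=
  (integrable_exp_neg_mul_norm_sq hc).ofReal.mul_bdd (c := C) hφ.aestronglyMeasurable
    (Filter.Eventually.of_forall hC)

theorem integral_exp_neg_mul_norm_sq_pos (hc : 0 < c) :
    0 < ∫ x : V, Real.exp (-c * ‖x‖ ^ 2) := by
  rw [GaussianFourier.integral_rexp_neg_mul_sq_norm hc]
  positivity

/-- Parallelogram law: with `x = y + u`, `2‖x‖² + 2‖y‖² = 4‖y + u/2‖² + ‖u‖²`. -/
theorem integral_integral_gauss_mul_gauss_mul_sub (hφ : Continuous φ) (hC : ∀ x, ‖φ x‖ ≤ C)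
    (hc : 0 < c) :
    ∫ y, ∫ x, (Real.exp (-(2 * c) * ‖y‖ ^ 2) : ℂ) * (Real.exp (-(2 * c) * ‖x‖ ^ 2) * φ (x - y)) =
      ((∫ y : V, Real.exp (-(4 * c) * ‖y‖ ^ 2) : ℝ) : ℂ) * ∫ u, gaussDamp c φ u := by
  set k : V × V → ℂ := fun p =>
    (Real.exp (-(2 * c) * ‖p.1‖ ^ 2) : ℂ) * (Real.exp (-(2 * c) * ‖p.2‖ ^ 2) * φ (p.2 - p.1))
    with k_def
  have integrable_gauss := (integrable_exp_neg_mul_norm_sq (V := V) (c := 2 * c)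
    (by positivity)).ofReal (𝕜 := ℂ)
  have integrable_k : Integrable k (volume.prod volume) := by
    refine ((integrable_gauss.mul_prod integrable_gauss).mul_bdd (c := C)
      (g := fun p => φ (p.2 - p.1)) (Continuous.aestronglyMeasurable (by fun_prop))
      (Filter.Eventually.of_forall fun p => hC _)).congr (Filter.Eventually.of_forall fun p => ?_)
    exact mul_assoc _ _ _
  have integrable_shear := (measurePreserving_prod_add (volume : Measure V)
    (volume : Measure V)).integrable_comp_of_integrable integrable_k
  have k_shear (y u : V) : k (y, y + u) =
      (Real.exp (-(4 * c) * ‖y + (1 / 2 : ℝ) • u‖ ^ 2) : ℂ) * gaussDamp c φ u := by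
    simp only [k_def, gaussDamp, add_sub_cancel_left, ← mul_assoc, ← Complex.ofReal_mul,
      ← Real.exp_add]
    congr 3
    rw [norm_add_sq_real, norm_add_sq_real, norm_smul, inner_smul_right]
    norm_num
    ring
  calc ∫ y, ∫ x, k (y, x) = ∫ y, ∫ u, k (y, y + u) := by
        congr 1 with y
        exact (integral_add_left_eq_self (fun x => k (y, x)) y).symm
    _ = ∫ u, ∫ y, k (y, y + u) := integral_integral_swap integrable_shear
    _ = _ := by
        simp_rw [k_shear, integral_mul_const, integral_add_right_eq_self fun y : V =>
          (Real.exp (-(4 * c) * ‖y‖ ^ 2) : ℂ), integral_const_mul, integral_complex_ofReal]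

theorem IsPosDefFun.integral_gaussDamp_nonneg (h : IsPosDefFun φ) (hφ : Continuous φ)
    (hc : 0 < c) : 0 ≤ ∫ u, gaussDamp c φ u := by
  set mass := ∫ x : V, Real.exp (-(2 * c) * ‖x‖ ^ 2)
  have mass_pos : 0 < mass := integral_exp_neg_mul_norm_sq_pos (by positivity)
  have integrable_density : Integrable fun x : V => Real.exp (-(2 * c) * ‖x‖ ^ 2) / mass :=
    (integrable_exp_neg_mul_norm_sq (by positivity)).div_const mass
  let ν : Measure V := volume.withDensity fun x =>
    ENNReal.ofReal (Real.exp (-(2 * c) * ‖x‖ ^ 2) / mass)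
  have isProbabilityMeasure : IsProbabilityMeasure ν := by
    constructor
    rw [withDensity_apply _ MeasurableSet.univ, Measure.restrict_univ,
      ← ofReal_integral_eq_lintegral_ofReal integrable_density
      (Filter.Eventually.of_forall fun x => by positivity), integral_div, div_self mass_pos.ne',
      ENNReal.ofReal_one]
  have integral_ν (f : V → ℂ) :
      ∫ x, f x ∂ν = (mass : ℂ)⁻¹ * ∫ x, (Real.exp (-(2 * c) * ‖x‖ ^ 2) : ℂ) * f x := by
    rw [integral_withDensity_eq_integral_toReal_smul (by fun_prop) (by simp),
      ← integral_const_mul]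
    congr 1 with x
    rw [ENNReal.toReal_ofReal (by positivity), Complex.real_smul, Complex.ofReal_div]
    ring
  have integrable_k : Integrable (Function.uncurry fun y x => φ (x - y)) (ν.prod ν) :=
    Integrable.of_bound (Continuous.aestronglyMeasurable (by fun_prop)) ‖φ 0‖
      (Filter.Eventually.of_forall fun p => h.norm_le _)
  have nonneg := integral_integral_nonneg_of_sum_nonneg integrable_k (by simp)
    fun n x => (h.sum_nonneg n x).trans_eq Finset.sum_comm
  have double_integral_eq : ∫ y, ∫ x, φ (x - y) ∂ν ∂ν = (((mass ^ 2)⁻¹ *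
      ∫ y : V, Real.exp (-(4 * c) * ‖y‖ ^ 2) : ℝ) : ℂ) * ∫ u, gaussDamp c φ u := by
    rw [Complex.ofReal_mul, mul_assoc,
      ← integral_integral_gauss_mul_gauss_mul_sub hφ h.norm_le hc]
    simp_rw [integral_ν, mul_left_comm _ (mass : ℂ)⁻¹, integral_const_mul, ← mul_assoc]
    push_cast
    ring
  rw [double_integral_eq] at nonneg
  have mass_four_pos : 0 < ∫ y : V, Real.exp (-(4 * c) * ‖y‖ ^ 2) :=
    integral_exp_neg_mul_norm_sq_pos (by positivity)
  have factor_pos : 0 < (mass ^ 2)⁻¹ * ∫ y : V, Real.exp (-(4 * c) * ‖y‖ ^ 2) := by positivity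
  simpa only [← mul_assoc, ← Complex.ofReal_mul, inv_mul_cancel₀ factor_pos.ne',
    Complex.ofReal_one, one_mul] using
    mul_nonneg (Complex.zero_le_real.mpr (inv_pos.mpr factor_pos).le) nonneg

theorem IsPosDefFun.fourier_gaussDamp_nonneg (h : IsPosDefFun φ) (hφ : Continuous φ)
    (hc : 0 < c) (w : V) : 0 ≤ FourierTransform.fourier (gaussDamp c φ) w := by
  let phase : V →+ ℝ := ((-2 * Real.pi) • (innerₗ V).flip w).toAddMonoidHom
  rw [Real.fourier_eq']
  refine ((h.mul (isPosDefFun_cexp_mul_I phase)).integral_gaussDamp_nonneg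
    (hφ.mul (show Continuous fun u : V =>
      Complex.exp (((-2 * Real.pi * ⟪u, w⟫_ℝ : ℝ) : ℂ) * Complex.I) by fun_prop)) hc).trans_eq ?_
  congr 1 with u
  exact (mul_assoc _ _ _).symm.trans (mul_comm _ _)

theorem integrable_of_integral_norm_gaussDamp_le {M : ℝ} (hφ : Continuous φ)
    (hM : ∀ w, ‖φ w‖ ≤ M) (hC : ∀ c > 0, ∫ w, ‖gaussDamp c φ w‖ ≤ C) : Integrable φ := by
  refine ⟨hφ.aestronglyMeasurable, hasFiniteIntegral_iff_enorm.mpr ?_⟩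
  calc ∫⁻ w, ‖φ w‖ₑ
      = ∫⁻ w, Filter.liminf (fun n : ℕ => ‖gaussDamp (1 / ((n : ℝ) + 1)) φ w‖ₑ) Filter.atTop :=
        lintegral_congr fun w => (tendsto_gaussDamp φ w).enorm.liminf_eq.symm
    _ ≤ Filter.liminf (fun n : ℕ => ∫⁻ w, ‖gaussDamp (1 / ((n : ℝ) + 1)) φ w‖ₑ) Filter.atTop :=
        lintegral_liminf_le fun n => (continuous_gaussDamp hφ).measurable.enorm
    _ ≤ ENNReal.ofReal C := by
        refine Filter.liminf_le_of_le (by isBoundedDefault) fun b hb => ?_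
        obtain ⟨n, hn⟩ := hb.exists
        refine hn.trans ?_
        rw [← ofReal_integral_norm_eq_lintegral_enorm
          (integrable_gaussDamp hφ hM (by positivity))]
        exact ENNReal.ofReal_le_ofReal (hC _ (by positivity))
    _ < ⊤ := ENNReal.ofReal_lt_top

theorem fourier_gauss {b : ℝ} (hb : 0 < b) (w : V) :
    FourierTransform.fourier (fun u : V => Complex.exp (-(b : ℂ) * ‖u‖ ^ 2)) w =
      (((Real.pi / b) ^ (Module.finrank ℝ V / 2 : ℝ) *
        Real.exp (-(Real.pi ^ 2 / b) * ‖w‖ ^ 2) : ℝ) : ℂ) := by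
  rw [fourier_gaussian_innerProductSpace (by simpa using hb), Complex.ofReal_mul,
    Complex.ofReal_cpow (by positivity)]
  push_cast
  ring_nf

theorem integral_norm_fourier_gauss {b : ℝ} (hb : 0 < b) :
    ∫ w : V, ‖FourierTransform.fourier (fun u : V => Complex.exp (-(b : ℂ) * ‖u‖ ^ 2)) w‖ = 1 := by
  have norm_eq (w : V) := congrArg norm (fourier_gauss hb w)
  simp_rw [Complex.norm_of_nonneg (show (0 : ℝ) ≤ (Real.pi / b) ^ (Module.finrank ℝ V / 2 : ℝ) *
    Real.exp (-(Real.pi ^ 2 / b) * ‖_‖ ^ 2) by positivity)] at norm_eq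
  simp_rw [norm_eq]
  rw [integral_const_mul, GaussianFourier.integral_rexp_neg_mul_sq_norm (by positivity),
    ← Real.mul_rpow (by positivity) (by positivity)]
  have base_eq_one : Real.pi / b * (Real.pi / (Real.pi ^ 2 / b)) = 1 := by field_simp
  rw [base_eq_one, Real.one_rpow]

theorem integral_norm_gaussDamp_fourier_le (hφ : Integrable φ) (hC : ∀ u, ‖φ u‖ ≤ C)
    (hnonneg : ∀ w, 0 ≤ FourierTransform.fourier φ w) (hc : 0 < c) :
    ∫ w, ‖gaussDamp c (FourierTransform.fourier φ) w‖ ≤ C := by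
  set gaussFourier := FourierTransform.fourier fun u : V => Complex.exp (-(c : ℂ) * ‖u‖ ^ 2)
  have integrable_gauss : Integrable fun u : V => Complex.exp (-(c : ℂ) * ‖u‖ ^ 2) := by
    simpa using (integrable_exp_neg_mul_norm_sq (V := V) hc).ofReal (𝕜 := ℂ)
  have integral_eq : ((∫ w, ‖gaussDamp c (FourierTransform.fourier φ) w‖ : ℝ) : ℂ) =
      ∫ w, gaussFourier w • φ w := by
    have flip := VectorFourier.integral_fourierIntegral_smul_eq_flip (L := innerₗ V)
      (μ := volume) (ν := volume) Real.continuous_fourierChar continuous_inner integrable_gauss hφ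
    rw [flip_innerₗ] at flip
    refine Eq.trans ?_ flip.symm
    rw [← integral_complex_ofReal]
    simp_rw [norm_gaussDamp_of_nonneg hnonneg, gaussDamp]
    push_cast
    rfl
  have integrable_gaussFourier : Integrable fun w => ‖gaussFourier w‖ :=
    Integrable.of_integral_ne_zero (by rw [integral_norm_fourier_gauss hc]; exact one_ne_zero)
  calc ∫ w, ‖gaussDamp c (FourierTransform.fourier φ) w‖
      ≤ ‖∫ w, gaussFourier w • φ w‖ := by
        rw [← integral_eq, Complex.norm_real]
        exact Real.le_norm_self _
    _ ≤ ∫ w, ‖gaussFourier w‖ * C := by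
        refine norm_integral_le_of_norm_le (integrable_gaussFourier.mul_const C)
          (Filter.Eventually.of_forall fun w => ?_)
        rw [norm_smul]
        exact mul_le_mul_of_nonneg_left (hC w) (norm_nonneg _)
    _ = C := by rw [integral_mul_const, integral_norm_fourier_gauss hc, one_mul]

theorem continuous_fourier (hφ : Integrable φ) : Continuous (FourierTransform.fourier φ) :=
  VectorFourier.fourierIntegral_continuous Real.continuous_fourierChar
    (by exact continuous_inner) hφ

theorem integrable_fourier_of_nonneg (hφ : Integrable φ) (hC : ∀ u, ‖φ u‖ ≤ C)
    (hnonneg : ∀ w, 0 ≤ FourierTransform.fourier φ w) :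
    Integrable (FourierTransform.fourier φ) :=
  integrable_of_integral_norm_gaussDamp_le (continuous_fourier hφ)
    (fun _ => VectorFourier.norm_fourierIntegral_le_integral_norm _ _ _ _ _)
    fun _ => integral_norm_gaussDamp_fourier_le hφ hC hnonneg

/-- By Fourier inversion the measure has density `𝓕 φ`, up to the factor `2π` relating `charFun` to
`𝓕`. -/
theorem exists_charFun_eq_of_fourier_nonneg (hcont : Continuous φ) (hφ : Integrable φ)
    (hC : ∀ u, ‖φ u‖ ≤ C) (h0 : φ 0 = 1) (hnonneg : ∀ w, 0 ≤ FourierTransform.fourier φ w) :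
    ∃ μ : ProbabilityMeasure V, ∀ t, charFun (μ : Measure V) t = φ t := by
  have inversion := hcont.fourierInv_fourier_eq hφ (integrable_fourier_of_nonneg hφ hC hnonneg)
  let ν : Measure V := volume.withDensity fun w => (‖FourierTransform.fourier φ w‖₊ : ℝ≥0∞)
  have charFun_eq (t : V) : charFun (ν.map fun x => (2 * Real.pi) • x) t = φ t := by
    rw [charFun_map_smul, charFun_apply, ← congrFun inversion t, Real.fourierInv_eq',
      integral_withDensity_eq_integral_smul (continuous_fourier hφ).nnnorm.measurable]
    congr 1 with w
    rw [NNReal.smul_def, coe_nnnorm, Complex.real_smul, ← Complex.eq_coe_norm_of_nonneg (hnonneg w),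
      smul_eq_mul, mul_comm, inner_smul_right]
  have isProbabilityMeasure : IsProbabilityMeasure (ν.map fun x => (2 * Real.pi) • x) :=
    ⟨(ENNReal.toReal_eq_one_iff _).mp
      (Complex.ofReal_eq_one.mp ((charFun_zero _).symm.trans ((charFun_eq 0).trans h0)))⟩
  exact ⟨⟨_, isProbabilityMeasure⟩, charFun_eq⟩

theorem IsPosDefFun.exists_charFun_eq_gaussDamp (h : IsPosDefFun φ) (hφ : Continuous φ)
    (h0 : φ 0 = 1) (hc : 0 < c) :
    ∃ μ : ProbabilityMeasure V, ∀ t, charFun (μ : Measure V) t = gaussDamp c φ t :=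
  exists_charFun_eq_of_fourier_nonneg (continuous_gaussDamp hφ)
    (integrable_gaussDamp hφ h.norm_le hc)
    (norm_gaussDamp_le hc.le h.norm_le) ((gaussDamp_zero_right c φ).trans h0)
    (h.fourier_gaussDamp_nonneg hφ hc)

theorem IsPosDefFun.exists_charFun_eq (h : IsPosDefFun φ) (hφ : Continuous φ) (h0 : φ 0 = 1) :
    ∃ μ : ProbabilityMeasure V, ∀ t, charFun (μ : Measure V) t = φ t := by
  choose μ charFun_μ using fun n : ℕ =>
    h.exists_charFun_eq_gaussDamp hφ h0 (Nat.one_div_pos_of_nat (α := ℝ) (n := n))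
  have tendsto_charFun (t : V) : Filter.Tendsto (fun n => charFun (μ n : Measure V) t)
      Filter.atTop (nhds (φ t)) := by
    simpa only [charFun_μ] using tendsto_gaussDamp φ t
  have tight := isTightMeasureSet_of_tendsto_charFun (μ := fun n => (μ n : Measure V))
    hφ.continuousAt tendsto_charFun
  have compact : IsCompact (closure (Set.range μ)) :=
    isCompact_closure_of_isTightMeasureSet (by
      simp only [Set.exists_range_iff]
      exact tight)
  obtain ⟨μ₀, -, subseq, strictMono, tendsto_μ₀⟩ :=
    compact.tendsto_subseq fun n => subset_closure (Set.mem_range_self n)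
  exact ⟨μ₀, fun t => tendsto_nhds_unique
    (ProbabilityMeasure.tendsto_iff_tendsto_charFun.mp tendsto_μ₀ t)
    ((tendsto_charFun t).comp strictMono.tendsto_atTop)⟩

end GaussianDamping

/-! ### Positive semidefinite kernels on phase space -/

section PosSemidef

variable {ι : Type*} [Finite ι]

theorem posSemidef_of_tendsto {A : ℕ → Matrix ι ι ℂ} {B : Matrix ι ι ℂ}
    (hA : ∀ n, (A n).PosSemidef) (tendsto : Filter.Tendsto A Filter.atTop (nhds B)) :
    B.PosSemidef := by
  cases nonempty_fintype ι
  refine PosSemidef.of_dotProduct_mulVec_nonneg ?_ fun x => ?_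
  · exact tendsto_nhds_unique (tendsto.star.congr fun n => (hA n).isHermitian) tendsto
  · have continuous_form : Continuous fun M : Matrix ι ι ℂ => star x ⬝ᵥ M *ᵥ x := by fun_prop
    exact ge_of_tendsto' ((continuous_form.tendsto B).comp tendsto)
      fun n => (hA n).dotProduct_mulVec_nonneg x

theorem posSemidef_map_pow {A : Matrix ι ι ℂ} (hA : A.PosSemidef) (k : ℕ) :
    (A.map (· ^ k)).PosSemidef := by
  cases nonempty_fintype ι
  induction k with
  | zero =>
    refine (congrArg PosSemidef ?_).mp (posSemidef_vecMulVec_self_star fun _ : ι => (1 : ℂ))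
    ext i j
    simp [vecMulVec_apply]
  | succ k ih =>
    refine (congrArg PosSemidef ?_).mp (ih.hadamard hA)
    ext i j
    simp [pow_succ]

theorem posSemidef_map_exp {A : Matrix ι ι ℂ} (hA : A.PosSemidef) :
    (A.map Complex.exp).PosSemidef := by
  cases nonempty_fintype ι
  refine posSemidef_of_tendsto (A := fun N => ∑ k ∈ Finset.range N,
    ((k.factorial : ℂ)⁻¹ • A.map (· ^ k))) (fun N => posSemidef_sum _ fun k _ =>
      (posSemidef_map_pow hA k).smul (by positivity)) ?_
  refine tendsto_pi_nhds.mpr fun i => tendsto_pi_nhds.mpr fun j => ?_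
  have tendsto_exp := (NormedSpace.expSeries_div_hasSum_exp (A i j)).tendsto_sum_nat
  rw [← Complex.exp_eq_exp_ℂ] at tendsto_exp
  exact tendsto_exp.congr fun N => by simp [Matrix.sum_apply, div_eq_inv_mul]

variable {A : Type*} [MeasurableSpace A] {m : Measure A}

theorem posSemidef_integral {K : A → Matrix ι ι ℂ} (hK : ∀ a, (K a).PosSemidef)
    (integrable : ∀ i j, Integrable (fun a => K a i j) m) :
    (Matrix.of fun i j => ∫ a, K a i j ∂m).PosSemidef := by
  cases nonempty_fintype ι
  refine PosSemidef.of_dotProduct_mulVec_nonneg ?_ fun x => ?_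
  · ext i j
    simp only [conjTranspose_apply, of_apply, RCLike.star_def, ← integral_conj,
      ← (hK _).isHermitian.apply i j]
  · have form_eq : star x ⬝ᵥ (Matrix.of fun i j => ∫ a, K a i j ∂m) *ᵥ x =
        ∫ a, star x ⬝ᵥ K a *ᵥ x ∂m := by
      simp only [dotProduct, mulVec, of_apply]
      rw [integral_finsetSum _ fun i _ => (integrable_finsetSum _ fun j _ =>
        (integrable i j).mul_const _).const_mul _]
      simp_rw [integral_const_mul, integral_finsetSum _ fun j _ => (integrable _ j).mul_const _,
        integral_mul_const]
    exact form_eq ▸ integral_nonneg fun a => (hK a).dotProduct_mulVec_nonneg x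

theorem IsPosDefFun.integral {V : Type*} [AddGroup V] {φ : A → V → ℂ}
    (hφ : ∀ a, IsPosDefFun (φ a)) (integrable : ∀ x, Integrable (fun a => φ a x) m) :
    IsPosDefFun fun x => ∫ a, φ a x ∂m :=
  fun n x => posSemidef_integral (fun a => hφ a n x) fun _ _ => integrable _

theorem posSemidef_fin_two {a c : ℝ} {b : ℂ} (ha : 0 ≤ a) (hc : 0 ≤ c) (hb : ‖b‖ ^ 2 ≤ a * c) :
    (!![(a : ℂ), b; starRingEnd ℂ b, (c : ℂ)]).PosSemidef := by
  refine PosSemidef.of_dotProduct_mulVec_nonneg ?_ fun x => ?_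
  · ext i j
    fin_cases i <;> fin_cases j <;> simp
  · have form_eq : star x ⬝ᵥ (!![(a : ℂ), b; starRingEnd ℂ b, (c : ℂ)] *ᵥ x) =
        ((a * ‖x 0‖ ^ 2 + c * ‖x 1‖ ^ 2 + 2 * (starRingEnd ℂ (x 0) * b * x 1).re : ℝ) : ℂ) := by
      simp only [dotProduct, mulVec, Fin.sum_univ_two, Complex.sq_norm, Complex.normSq_apply]
      apply Complex.ext <;> simp <;> ring
    rw [form_eq, Complex.zero_le_real]
    have cross_term_ge : -(‖x 0‖ * ‖b‖ * ‖x 1‖) ≤ (starRingEnd ℂ (x 0) * b * x 1).re := by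
      simpa using (abs_le.mp (Complex.abs_re_le_norm (starRingEnd ℂ (x 0) * b * x 1))).1
    have norm_b_le : ‖b‖ ≤ √a * √c := by
      rw [← Real.sqrt_mul ha]
      exact Real.le_sqrt_of_sq_le hb
    have cross_term_le : ‖x 0‖ * ‖b‖ * ‖x 1‖ ≤ ‖x 0‖ * (√a * √c) * ‖x 1‖ := by gcongr
    nlinarith [sq_nonneg (√a * ‖x 0‖ - √c * ‖x 1‖), Real.sq_sqrt ha, Real.sq_sqrt hc]

end PosSemidef

/-- The action of a real `2 × 2` matrix on the phase space `ℂ`, identified with `ℝ²` through real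
and imaginary parts. -/
noncomputable def matAct (X : Matrix (Fin 2) (Fin 2) ℝ) : ℂ →ₗ[ℝ] ℂ :=
  toLin Complex.basisOneI Complex.basisOneI X

/-- The bilinear form `ξᵀ Y η` of a real `2 × 2` matrix on the phase space `ℂ`. -/
noncomputable def bilin (Y : Matrix (Fin 2) (Fin 2) ℝ) : LinearMap.BilinForm ℝ ℂ :=
  toBilin Complex.basisOneI Y

section PhaseSpace

variable (X Y Z : Matrix (Fin 2) (Fin 2) ℝ) (ξ η : ℂ)

theorem matAct_apply :
    matAct X ξ = ⟨X 0 0 * ξ.re + X 0 1 * ξ.im, X 1 0 * ξ.re + X 1 1 * ξ.im⟩ := by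
  apply Complex.ext <;> simp [matAct, toLin_apply, mulVec, dotProduct]

theorem bilin_apply : bilin Y ξ η =
    ξ.re * (Y 0 0 * η.re + Y 0 1 * η.im) + ξ.im * (Y 1 0 * η.re + Y 1 1 * η.im) := by
  simp only [bilin, toBilin_apply, Fin.sum_univ_two, Complex.coe_basisOneI_repr, cons_val_zero,
    cons_val_one]
  ring

theorem matAct_mul : matAct (X * Y) ξ = matAct X (matAct Y ξ) := by
  rw [matAct, toLin_mul _ Complex.basisOneI]
  rfl

theorem bilin_one_self : bilin 1 ξ ξ = ‖ξ‖ ^ 2 := by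
  simp [bilin_apply, Complex.sq_norm, Complex.normSq_apply]

theorem bilin_transpose_mul_mul_self :
    bilin (Xᵀ * Y * X) ξ ξ = bilin Y (matAct X ξ) (matAct X ξ) := by
  simp only [bilin_apply, matAct_apply, mul_apply, transpose_apply, Fin.sum_univ_two]
  ring

theorem bilin_sub_one_self : bilin (Y - 1) ξ ξ = bilin Y ξ ξ - ‖ξ‖ ^ 2 := by
  rw [← bilin_one_self, bilin, map_sub]
  rfl

theorem symp_matAct : symp (matAct X ξ) (matAct X η) = X.det * symp ξ η := by
  simp only [symp_apply, matAct_apply, det_fin_two]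
  ring

variable {Y} in
theorem posSemidef_of_bilin_nonneg (hY : Y.IsSymm) (nonneg : ∀ ξ, 0 ≤ bilin Y ξ ξ) :
    Y.PosSemidef := by
  refine PosSemidef.of_dotProduct_mulVec_nonneg hY fun x => ?_
  simpa [bilin_apply, dotProduct, mulVec, Fin.sum_univ_two] using nonneg ⟨x 0, x 1⟩

variable {Z} in
/-- Writing `w k = (re (x k), im (x k))` and `H = Z + i d β`, the exponent is
`-(w i)ᵀ Z (w i) / 2 - (w j)ᵀ Z (w j) / 2 + (w i)ᵀ H (w j)`, and `H ≥ 0`. -/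
theorem posSemidef_gauss_kernel (hZ : Z.PosSemidef) {d : ℝ} (hd : d ^ 2 ≤ Z.det)
    {ι : Type*} [Finite ι] (x : ι → ℂ) :
    (Matrix.of fun i j => Complex.exp (((-bilin Z (x i - x j) (x i - x j) / 2 : ℝ) : ℂ) -
      ((d * symp (x i) (x j) : ℝ) : ℂ) * Complex.I)).PosSemidef := by
  cases nonempty_fintype ι
  have symm : Z 1 0 = Z 0 1 := hZ.isHermitian.apply 0 1
  have posSemidef_H : (!![(Z 0 0 : ℂ), ⟨Z 0 1, d⟩; starRingEnd ℂ ⟨Z 0 1, d⟩,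
      (Z 1 1 : ℂ)]).PosSemidef := by
    refine posSemidef_fin_two hZ.diag_nonneg hZ.diag_nonneg ?_
    rw [Complex.sq_norm, Complex.normSq_mk]
    rw [det_fin_two, symm] at hd
    linarith
  let W : Matrix ι (Fin 2) ℂ := Matrix.of fun i => ![((x i).re : ℂ), ((x i).im : ℂ)]
  refine (congrArg PosSemidef ?_).mp
    ((posSemidef_map_exp (posSemidef_H.mul_mul_conjTranspose_same W)).hadamard
    (posSemidef_vecMulVec_self_star fun i => Complex.exp (-bilin Z (x i) (x i) / 2 : ℝ)))
  ext i j
  simp only [hadamard_apply, map_apply, of_apply, vecMulVec_apply, Pi.star_apply,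
    RCLike.star_def, ← Complex.exp_conj, Complex.conj_ofReal, ← Complex.exp_add]
  congr 1
  simp only [mul_apply, Fin.sum_univ_two, W, of_apply, conjTranspose_apply,
    cons_val_zero, cons_val_one, RCLike.star_def, Complex.conj_ofReal]
  apply Complex.ext <;> simp [bilin_apply, symp_apply, symm] <;> ring

end PhaseSpace

section Char

variable {A : Type*} [MeasurableSpace A] {m : Measure A} {v : A → Mode} {ρ : Mode →L[ℂ] Mode}

theorem IsMixture.continuous_char (h : IsMixture m v ρ) :
    Continuous fun ξ : ℂ => trace (displacement ξ ∘L ρ) := by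
  simp_rw [h.trace_comp]
  refine continuous_of_dominated (bound := fun a => ‖v a‖ ^ 2) (fun ξ => ?_) (fun ξ => ?_)
    h.integrable_norm_sq (Filter.Eventually.of_forall fun a => continuous_inner_displacement _ _)
  · exact h.aestronglyMeasurable.inner
      ((displacement ξ).continuous.comp_aestronglyMeasurable h.aestronglyMeasurable)
  · exact Filter.Eventually.of_forall fun a =>
      (norm_inner_displacement_le _ _ _).trans_eq (sq _).symm

theorem IsMixture.integrable_inner_displacement (h : IsMixture m v ρ) (α β : ℂ) :
    Integrable (fun a => ⟪displacement α (v a), displacement β (v a)⟫_ℂ) m := by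
  refine h.integrable_norm_sq.mono' ?_ (Filter.Eventually.of_forall fun a => ?_)
  · exact ((displacement α).continuous.comp_aestronglyMeasurable h.aestronglyMeasurable).inner
      ((displacement β).continuous.comp_aestronglyMeasurable h.aestronglyMeasurable)
  · refine (norm_inner_le_norm _ _).trans_eq ?_
    rw [norm_displacement, norm_displacement, sq]

theorem inner_displacement_displacement_eq (α β : ℂ) (u w : Mode) :
    ⟪displacement β u, displacement α w⟫_ℂ =
      Complex.exp (symp α β * Complex.I) * ⟪u, displacement (α - β) w⟫_ℂ := by
  rw [inner_displacement_left, displacement_displacement, inner_smul_right, neg_add_eq_sub,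
    map_neg, LinearMap.neg_apply, ← symp_swap]

theorem IsMixture.exp_symp_mul_trace_displacement_sub (h : IsMixture m v ρ) (α β : ℂ) :
    Complex.exp (symp α β * Complex.I) * trace (displacement (α - β) ∘L ρ) =
      ∫ a, ⟪displacement β (v a), displacement α (v a)⟫_ℂ ∂m := by
  simp_rw [h.trace_comp, inner_displacement_displacement_eq, integral_const_mul]

theorem IsMixture.posSemidef_char (h : IsMixture m v ρ) {ι : Type*} [Finite ι] (x : ι → ℂ) :
    (Matrix.of fun i j => Complex.exp (symp (x i) (x j) * Complex.I) *
      trace (displacement (x i - x j) ∘L ρ)).PosSemidef := by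
  simp_rw [h.exp_symp_mul_trace_displacement_sub]
  exact posSemidef_integral
    (fun a => (posSemidef_gram ℂ fun i => displacement (x i) (v a)).transpose)
    fun i j => h.integrable_inner_displacement _ _

theorem IsMixture.isPosDefFun_char_mul_gauss (h : IsMixture m v ρ)
    {X Z : Matrix (Fin 2) (Fin 2) ℝ} (hZ : Z.PosSemidef) (hd : X.det ^ 2 ≤ Z.det) :
    IsPosDefFun fun ξ : ℂ => trace (displacement (matAct X ξ) ∘L ρ) *
      Real.exp (-bilin Z ξ ξ / 2) := by
  intro n x
  refine (congrArg PosSemidef ?_).mp ((h.posSemidef_char fun i => matAct X (x i)).hadamard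
    (posSemidef_gauss_kernel hZ hd x))
  ext i j
  simp only [hadamard_apply, of_apply, symp_matAct, ← map_sub]
  rw [mul_right_comm, ← Complex.exp_add, mul_comm, Complex.ofReal_exp]
  congr 2
  ring

end Char

/-! ### Nonclassicality breaking and positive definiteness -/

theorem trace_displacement_zero_comp (ρ : Mode →L[ℂ] Mode) :
    trace (displacement 0 ∘L ρ) = trace ρ := by
  congr 1
  ext1 f
  simp

/-- The function `ξ ↦ χ(ξ; σ) exp(‖ξ‖² / 2)` is the characteristic function of the diagonal weight
of `σ`, with argument rotated and scaled: `χ(ξ; |α⟩⟨α|) = exp(2 i (ξ₂ α₁ - ξ₁ α₂) - ‖ξ‖² / 2)`. -/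
theorem isClassical_iff_isPosDefFun {σ : Mode →L[ℂ] Mode} (hσ : IsDensity σ) :
    IsClassical σ ↔
      IsPosDefFun fun ξ => trace (displacement ξ ∘L σ) * Real.exp (‖ξ‖ ^ 2 / 2) := by
  constructor
  · intro hcl
    obtain ⟨μ, _, hμ⟩ := isClassical_iff_exists_isMixture.mp hcl
    have char_eq (ξ : ℂ) : trace (displacement ξ ∘L σ) * Real.exp (‖ξ‖ ^ 2 / 2) =
        ∫ α, Complex.exp (((2 * symp ξ α : ℝ) : ℂ) * Complex.I) ∂μ := by
      simp_rw [hμ.trace_comp, inner_coherent_displacement_self, integral_mul_const, mul_assoc,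
        ← Complex.ofReal_mul, ← Real.exp_add, neg_div, neg_add_cancel, Real.exp_zero,
        Complex.ofReal_one, mul_one]
    simp_rw [char_eq]
    refine IsPosDefFun.integral
      (fun α => isPosDefFun_cexp_mul_I ((2 : ℝ) • symp.flip α).toAddMonoidHom) fun ξ => ?_
    refine Integrable.of_bound (Continuous.aestronglyMeasurable ?_) 1
      (Filter.Eventually.of_forall fun α => (Complex.norm_exp_ofReal_mul_I _).le)
    simp only [symp_apply]
    fun_prop
  · intro hpd
    obtain ⟨A, _, m, v, _, hv⟩ := hσ.exists_isMixture
    obtain ⟨ν, charFun_ν⟩ := hpd.exists_charFun_eq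
      (hv.continuous_char.mul (by fun_prop)) (by simp [trace_displacement_zero_comp, hσ.2.trace_eq])
    have measurable_rotate : Measurable fun x : ℂ => -(Complex.I / 2) * x := by fun_prop
    have : IsProbabilityMeasure ((ν : Measure ℂ).map fun x => -(Complex.I / 2) * x) :=
      Measure.isProbabilityMeasure_map measurable_rotate.aemeasurable
    refine hv.isClassical_of_trace_eq ((ν : Measure ℂ).map fun x => -(Complex.I / 2) * x)
      fun ξ => ?_
    have two_mul_symp_rotate (x : ℂ) : 2 * symp ξ (-(Complex.I / 2) * x) = ⟪x, ξ⟫_ℝ := by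
      simp [symp_apply, Complex.inner]
      ring
    simp_rw [inner_coherent_displacement_self]
    rw [integral_mul_const, integral_map measurable_rotate.aemeasurable
      (Continuous.aestronglyMeasurable (by simp only [symp_apply]; fun_prop))]
    simp_rw [two_mul_symp_rotate]
    rw [← charFun_apply, charFun_ν, mul_assoc, ← Complex.ofReal_mul, ← Real.exp_add, neg_div,
      add_neg_cancel, Real.exp_zero, Complex.ofReal_one, mul_one]

theorem isPositive_iff_inner_nonneg {T : Mode →L[ℂ] Mode} :
    T.IsPositive ↔ ∀ f, 0 ≤ ⟪f, T f⟫_ℂ := by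
  refine ⟨fun h f => h.inner_nonneg_right f, fun h =>
    (ContinuousLinearMap.isPositive_iff_complex T).mpr fun f => ?_⟩
  rw [← inner_conj_symm, Complex.eq_coe_norm_of_nonneg (h f), Complex.conj_ofReal]
  exact ⟨rfl, (norm_nonneg (⟪f, T f⟫_ℂ)).trans_eq (Complex.ofReal_re _).symm⟩

@[simp]
theorem IsDensity.coe_toTraceClass {ρ : Mode →L[ℂ] Mode} (hρ : IsDensity ρ) :
    (hρ.toTraceClass : Mode →L[ℂ] Mode) = ρ := rfl

theorem IsChannel.isDensity {Γ : traceClass →ₗ[ℂ] traceClass} (hΓ : IsChannel Γ)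
    {ρ : Mode →L[ℂ] Mode} (hρ : IsDensity ρ) :
    IsDensity (Γ hρ.toTraceClass : Mode →L[ℂ] Mode) := by
  constructor
  · refine isPositive_iff_inner_nonneg.mpr fun f => ?_
    simpa using hΓ.completely_positive 1 (fun _ _ => hρ.toTraceClass)
      (fun v => by simpa using isPositive_iff_inner_nonneg.mp hρ.1 (v 0)) fun _ => f
  · have hasTrace_out := hasTrace_comp (ContinuousLinearMap.id ℂ Mode) (Γ hρ.toTraceClass)
    rwa [ContinuousLinearMap.id_comp, hΓ.trace_preserving, hρ.coe_toTraceClass,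
      hρ.2.trace_eq] at hasTrace_out

namespace IsGaussianChannel

variable {Γ : traceClass →ₗ[ℂ] traceClass} {X Y : Matrix (Fin 2) (Fin 2) ℝ}

theorem trace_displacement_out (hΓ : IsGaussianChannel Γ X Y) {ρ : Mode →L[ℂ] Mode}
    (hρ : IsDensity ρ) (ξ : ℂ) :
    trace (displacement ξ ∘L (Γ hρ.toTraceClass : Mode →L[ℂ] Mode)) =
      trace (displacement (matAct X ξ) ∘L ρ) * Real.exp (-bilin Y ξ ξ / 2) := by
  have matAct_eq : (⟨(X *ᵥ ![ξ.re, ξ.im]) 0, (X *ᵥ ![ξ.re, ξ.im]) 1⟩ : ℂ) = matAct X ξ := by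
    simp [matAct_apply, mulVec, dotProduct]
  have bilin_eq : ![ξ.re, ξ.im] ⬝ᵥ Y *ᵥ ![ξ.re, ξ.im] = bilin Y ξ ξ := by
    simp [bilin_apply, mulVec, dotProduct]
  have weylChar_out := hΓ.weylChar_out ρ hρ ![ξ.re, ξ.im]
  rwa [weylChar, weylChar, matAct_eq, bilin_eq] at weylChar_out

theorem nonclassicalityBreaking_iff_isPosDefFun (hΓ : IsGaussianChannel Γ X Y) :
    NonclassicalityBreaking Γ ↔ ∀ ρ : Mode →L[ℂ] Mode, IsDensity ρ →
      IsPosDefFun fun ξ => trace (displacement (matAct X ξ) ∘L ρ) *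
        Real.exp (-bilin (Y - 1) ξ ξ / 2) := by
  refine forall₂_congr fun ρ hρ => ?_
  rw [isClassical_iff_isPosDefFun (hΓ.toIsChannel.isDensity hρ)]
  simp_rw [hΓ.trace_displacement_out, bilin_sub_one_self, mul_assoc, ← Complex.ofReal_mul,
    ← Real.exp_add]
  ring_nf

theorem nonclassicalityBreaking (hΓ : IsGaussianChannel Γ X Y) (hY : (Y - 1).PosSemidef)
    (hd : X.det ^ 2 ≤ (Y - 1).det) : NonclassicalityBreaking Γ := by
  refine hΓ.nonclassicalityBreaking_iff_isPosDefFun.mpr fun ρ hρ => ?_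
  obtain ⟨A, _, m, v, _, hv⟩ := hρ.exists_isMixture
  exact hv.isPosDefFun_char_mul_gauss hY hd

end IsGaussianChannel

/-! ### Necessary conditions -/

section CoshGauss

variable {V : Type*} [NormedAddCommGroup V] [InnerProductSpace ℝ V]

theorem gauss_mul_cosh_eq (b : ℝ) (c : ℂ) (w v : V) :
    Complex.exp (-b * ‖v‖ ^ 2) * Complex.cosh (c * ⟪w, v⟫_ℝ) =
      (Complex.exp (-b * ‖v‖ ^ 2 + c * ⟪w, v⟫_ℝ) +
        Complex.exp (-b * ‖v‖ ^ 2 + -c * ⟪w, v⟫_ℝ)) / 2 := by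
  rw [Complex.cosh, Complex.exp_add, Complex.exp_add, neg_mul c]
  ring

variable [FiniteDimensional ℝ V] [MeasurableSpace V] [BorelSpace V] {b : ℝ}

theorem integrable_gauss_mul_cosh (hb : 0 < b) (c : ℂ) (w : V) :
    Integrable fun v : V => Complex.exp (-b * ‖v‖ ^ 2) * Complex.cosh (c * ⟪w, v⟫_ℝ) := by
  simp_rw [gauss_mul_cosh_eq]
  have integrable (c : ℂ) := GaussianFourier.integrable_cexp_neg_mul_sq_norm_add
    (show 0 < (b : ℂ).re from hb) c w
  exact ((integrable c).add (integrable (-c))).div_const 2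

theorem integral_gauss_mul_cosh (hb : 0 < b) (c : ℂ) (w : V) :
    ∫ v : V, Complex.exp (-b * ‖v‖ ^ 2) * Complex.cosh (c * ⟪w, v⟫_ℝ) =
      ((Real.pi / b) ^ (Module.finrank ℝ V / 2 : ℝ) : ℝ) *
        Complex.exp (c ^ 2 * ‖w‖ ^ 2 / (4 * b)) := by
  have re_pos : 0 < (b : ℂ).re := hb
  have integrable (c : ℂ) := GaussianFourier.integrable_cexp_neg_mul_sq_norm_add re_pos c w
  simp_rw [gauss_mul_cosh_eq]
  rw [integral_div, integral_add (integrable c) (integrable (-c)),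
    GaussianFourier.integral_cexp_neg_mul_sq_norm_add re_pos,
    GaussianFourier.integral_cexp_neg_mul_sq_norm_add re_pos, neg_sq,
    Complex.ofReal_cpow (by positivity)]
  push_cast
  ring

theorem integral_gaussDamp_gauss_mul_cosh_sub_cosh {c : ℝ} (hc : 0 < c) (s t : V) :
    ∫ v : V, gaussDamp c (fun v => Complex.exp (-‖v‖ ^ 2 / 2) *
      (2 * (Complex.cosh (2 * Complex.I * ⟪t, v⟫_ℝ) -
        Complex.exp (-2) * Complex.cosh (2 * ⟪s, v⟫_ℝ)))) v =
    ((2 * (Real.pi / (c + 1 / 2)) ^ (Module.finrank ℝ V / 2 : ℝ) *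
      (Real.exp (-‖t‖ ^ 2 / (c + 1 / 2)) - Real.exp (-2 + ‖s‖ ^ 2 / (c + 1 / 2))) : ℝ) : ℂ) := by
  obtain ⟨b, hb⟩ : ∃ b, b = c + 1 / 2 := ⟨_, rfl⟩
  have b_pos : 0 < b := by rw [hb]; positivity
  have damp_eq (v : V) : gaussDamp c (fun v : V => Complex.exp (-‖v‖ ^ 2 / 2) *
      (2 * (Complex.cosh (2 * Complex.I * ⟪t, v⟫_ℝ) -
        Complex.exp (-2) * Complex.cosh (2 * ⟪s, v⟫_ℝ)))) v =
      2 * (Complex.exp (-b * ‖v‖ ^ 2) * Complex.cosh (2 * Complex.I * ⟪t, v⟫_ℝ) -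
        Complex.exp (-2) * (Complex.exp (-b * ‖v‖ ^ 2) * Complex.cosh (2 * ⟪s, v⟫_ℝ))) := by
    have exp_eq : Complex.exp (-b * ‖v‖ ^ 2) =
        Real.exp (-c * ‖v‖ ^ 2) * Complex.exp (-‖v‖ ^ 2 / 2) := by
      rw [Complex.ofReal_exp, ← Complex.exp_add, hb]
      push_cast
      ring_nf
    rw [gaussDamp, exp_eq]
    ring
  simp_rw [damp_eq, ← hb]
  rw [integral_const_mul, integral_sub (integrable_gauss_mul_cosh b_pos _ _)
    ((integrable_gauss_mul_cosh b_pos _ _).const_mul _), integral_const_mul,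
    integral_gauss_mul_cosh b_pos, integral_gauss_mul_cosh b_pos, mul_pow, Complex.I_sq,
    Real.exp_add]
  generalize (Real.pi / b) ^ (Module.finrank ℝ V / 2 : ℝ) = K
  push_cast
  ring_nf

/-- The integral against `exp (-c ‖v‖²)` is nonnegative; let `c → 0`. -/
theorem norm_sq_add_norm_sq_le_one_of_isPosDefFun {s t : V}
    (h : IsPosDefFun fun v : V => Complex.exp (-‖v‖ ^ 2 / 2) *
      (2 * (Complex.cosh (2 * Complex.I * ⟪t, v⟫_ℝ) -
        Complex.exp (-2) * Complex.cosh (2 * ⟪s, v⟫_ℝ)))) :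
    ‖s‖ ^ 2 + ‖t‖ ^ 2 ≤ 1 := by
  refine le_of_forall_pos_le_add fun ε hε => ?_
  obtain ⟨b, hb⟩ : ∃ b, b = ε / 2 + 1 / 2 := ⟨_, rfl⟩
  have b_pos : 0 < b := by rw [hb]; positivity
  have integral_nonneg := h.integral_gaussDamp_nonneg (by fun_prop) (half_pos hε)
  rw [integral_gaussDamp_gauss_mul_cosh_sub_cosh (half_pos hε), ← hb,
    Complex.zero_le_real] at integral_nonneg
  have exp_le : Real.exp (-2 + ‖s‖ ^ 2 / b) ≤ Real.exp (-‖t‖ ^ 2 / b) :=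
    sub_nonneg.mp (nonneg_of_mul_nonneg_right integral_nonneg (by positivity))
  have div_le : (‖s‖ ^ 2 + ‖t‖ ^ 2) / b ≤ 2 := by
    rw [add_div]
    linarith [Real.exp_le_exp.mp exp_le, neg_div b (‖t‖ ^ 2)]
  linarith [(div_le_iff₀ b_pos).mp div_le]

end CoshGauss

theorem sum_norm_sq_le_norm_sum_sq {E ι : Type*} [NormedAddCommGroup E] [InnerProductSpace ℂ E]
    (s : Finset ι) {w : ι → E} (hw : ∀ j ∈ s, ∀ k ∈ s, 0 ≤ RCLike.re ⟪w j, w k⟫_ℂ) :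
    ∑ j ∈ s, ‖w j‖ ^ 2 ≤ ‖∑ j ∈ s, w j‖ ^ 2 := by
  rw [← inner_self_eq_norm_sq (𝕜 := ℂ), sum_inner, map_sum]
  refine Finset.sum_le_sum fun j hj => ?_
  rw [inner_sum, map_sum, ← inner_self_eq_norm_sq (𝕜 := ℂ)]
  exact Finset.single_le_sum (f := fun k => RCLike.re ⟪w j, w k⟫_ℂ) (hw j hj) hj

theorem displacement_coherent_smul (k : ℝ) (η : ℂ) :
    displacement η (coherent (k • η)) = coherent ((k + 1) • η) := by
  rw [coherent, displacement_displacement, map_smul, symp_self, add_smul, one_smul, add_comm,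
    coherent]
  simp

theorem re_inner_coherent_smul_nonneg (s t : ℝ) (η : ℂ) :
    0 ≤ RCLike.re ⟪coherent (s • η), coherent (t • η)⟫_ℂ := by
  rw [coherent, coherent, inner_displacement_displacement_eq, inner_vacuum_displacement_vacuum,
    map_smul, map_smul, LinearMap.smul_apply, symp_self, smul_zero, smul_zero, Complex.ofReal_zero,
    zero_mul, Complex.exp_zero, one_mul, RCLike.re_to_complex, Complex.ofReal_re]
  positivity

/-- The sum of `n` coherent states at equally spaced points `0, η, …, (n - 1) η` is an approximate
eigenvector of `D(η)`: applying `D(η)` only changes the first and last terms. -/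
theorem exists_norm_displacement_sub_le (η : ℂ) (R : ℝ) :
    ∃ u : Mode, R ≤ ‖u‖ ∧ ‖displacement η u - u‖ ≤ 2 := by
  obtain ⟨n, hn⟩ := exists_nat_ge (R ^ 2)
  refine ⟨∑ k ∈ Finset.range n, coherent ((k : ℝ) • η), ?_, ?_⟩
  · have sum_le := sum_norm_sq_le_norm_sum_sq (Finset.range n) fun j _ k _ =>
      re_inner_coherent_smul_nonneg j k η
    simp only [norm_coherent, one_pow, Finset.sum_const, Finset.card_range, nsmul_eq_mul,
      mul_one] at sum_le
    exact (abs_le_of_sq_le_sq' (hn.trans sum_le) (norm_nonneg _)).2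
  · simp_rw [map_sum, displacement_coherent_smul, ← Nat.cast_add_one]
    rw [← Finset.sum_sub_distrib, Finset.sum_range_sub fun k : ℕ => coherent ((k : ℝ) • η)]
    refine (norm_sub_le _ _).trans ?_
    rw [norm_coherent, norm_coherent]
    norm_num

theorem inner_cat_displacement (ζ : ℂ) :
    ⟪coherent 1 - coherent (-1), displacement ζ (coherent 1 - coherent (-1))⟫_ℂ =
      Complex.exp (-‖ζ‖ ^ 2 / 2) * (2 * (Complex.cosh (2 * Complex.I * ζ.im) -
        Complex.exp (-2) * Complex.cosh (2 * ζ.re))) := by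
  have norm_sq_add_two : ‖ζ + 1 - -1‖ ^ 2 = ‖ζ‖ ^ 2 + 4 * ζ.re + 4 := by
    simp only [Complex.sq_norm, Complex.normSq_apply, Complex.add_re, Complex.add_im,
      Complex.sub_re, Complex.sub_im, Complex.neg_re, Complex.neg_im, Complex.one_re,
      Complex.one_im]
    ring
  have norm_sq_sub_two : ‖ζ + -1 - 1‖ ^ 2 = ‖ζ‖ ^ 2 - 4 * ζ.re + 4 := by
    simp only [Complex.sq_norm, Complex.normSq_apply, Complex.add_re, Complex.add_im,
      Complex.sub_re, Complex.sub_im, Complex.neg_re, Complex.neg_im, Complex.one_re,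
      Complex.one_im]
    ring
  rw [map_sub, inner_sub_left, inner_sub_right, inner_sub_right, inner_coherent_displacement_self,
    inner_coherent_displacement_self, inner_coherent_displacement_coherent,
    inner_coherent_displacement_coherent, norm_sq_add_two, norm_sq_sub_two]
  have symp_one : symp ζ 1 = ζ.im := by simp [symp_apply]
  have symp_neg_one : symp ζ (-1) = -ζ.im := by simp [symp_apply]
  have phase_one : symp ζ 1 - symp (-1) (ζ + 1) = 0 := by simp [symp_apply]
  have phase_neg_one : symp ζ (-1) - symp 1 (ζ + -1) = 0 := by simp [symp_apply]
  rw [phase_one, phase_neg_one, symp_one, symp_neg_one, Complex.cosh, Complex.cosh]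
  simp only [Complex.ofReal_exp, Complex.ofReal_zero, zero_mul, Complex.exp_zero, one_mul]
  have exp_add_four : Complex.exp ((-(‖ζ‖ ^ 2 + 4 * ζ.re + 4) / 2 : ℝ) : ℂ) =
      Complex.exp (-‖ζ‖ ^ 2 / 2) * Complex.exp (-2) * Complex.exp (-(2 * ζ.re)) := by
    rw [← Complex.exp_add, ← Complex.exp_add]
    push_cast
    ring_nf
  have exp_sub_four : Complex.exp ((-(‖ζ‖ ^ 2 - 4 * ζ.re + 4) / 2 : ℝ) : ℂ) =
      Complex.exp (-‖ζ‖ ^ 2 / 2) * Complex.exp (-2) * Complex.exp (2 * ζ.re) := by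
    rw [← Complex.exp_add, ← Complex.exp_add]
    push_cast
    ring_nf
  rw [exp_add_four, exp_sub_four]
  push_cast
  ring_nf

theorem sq_norm_sub_two_mul_le {u w : Mode} (hw : ‖w - u‖ ≤ 2) :
    ‖u‖ ^ 2 - 2 * ‖u‖ ≤ ‖⟪u, w⟫_ℂ‖ := by
  have norm_inner_self : ‖⟪u, u⟫_ℂ‖ = ‖u‖ ^ 2 := by
    rw [inner_self_eq_norm_sq_to_K]
    simp
  have norm_inner_sub_le : ‖⟪u, w - u⟫_ℂ‖ ≤ ‖u‖ * 2 :=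
    (norm_inner_le_norm _ _).trans (by gcongr)
  have norm_le := norm_sub_le ⟪u, w⟫_ℂ ⟪u, w - u⟫_ℂ
  rw [← inner_sub_right, sub_sub_cancel, norm_inner_self] at norm_le
  linarith

theorem sq_det_le_det_of_isPosDefFun {T W : Matrix (Fin 2) (Fin 2) ℝ} (hTW : Tᵀ * T + W = 1)
    (h : IsPosDefFun fun η => ⟪coherent 1 - coherent (-1),
      displacement (matAct T η) (coherent 1 - coherent (-1))⟫_ℂ *
        Real.exp (-bilin W η η / 2)) :
    T.det ^ 2 ≤ W.det := by
  have norm_sq_add (η : ℂ) : ‖matAct T η‖ ^ 2 + bilin W η η = ‖η‖ ^ 2 := by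
    rw [← bilin_one_self η, ← hTW, ← bilin_one_self, ← bilin_transpose_mul_mul_self,
      Matrix.mul_one, bilin, bilin, bilin, map_add]
    rfl
  have sum_le := norm_sq_add_norm_sq_le_one_of_isPosDefFun
    (s := (⟨T 0 0, T 0 1⟩ : ℂ)) (t := (⟨T 1 0, T 1 1⟩ : ℂ)) <| by
      refine (congrArg IsPosDefFun (funext fun η => ?_)).mp h
      have norm_sq_eq : (‖η‖ ^ 2 : ℂ) = ‖matAct T η‖ ^ 2 + bilin W η η :=
        mod_cast (norm_sq_add η).symm
      have re_eq : (matAct T η).re = ⟪(⟨T 0 0, T 0 1⟩ : ℂ), η⟫_ℝ := by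
        simp [matAct_apply, Complex.inner, mul_comm]
      have im_eq : (matAct T η).im = ⟪(⟨T 1 0, T 1 1⟩ : ℂ), η⟫_ℝ := by
        simp [matAct_apply, Complex.inner, mul_comm]
      rw [inner_cat_displacement, mul_right_comm, Complex.ofReal_exp, ← Complex.exp_add,
        norm_sq_eq, re_eq, im_eq]
      congr 2
      push_cast
      ring
  have W_eq : W = 1 - Tᵀ * T := eq_sub_of_add_eq' hTW
  rw [Complex.sq_norm, Complex.sq_norm, Complex.normSq_mk, Complex.normSq_mk] at sum_le
  simp only [W_eq, det_fin_two, Matrix.sub_apply, mul_apply, transpose_apply, Fin.sum_univ_two,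
    one_apply_eq, one_apply_ne (zero_ne_one' (Fin 2)), one_apply_ne (one_ne_zero' (Fin 2))]
  linarith

namespace IsGaussianChannel

variable {Γ : traceClass →ₗ[ℂ] traceClass} {X Y : Matrix (Fin 2) (Fin 2) ℝ}

theorem isPosDefFun_inner (hΓ : IsGaussianChannel Γ X Y) (hNB : NonclassicalityBreaking Γ)
    (u : Mode) : IsPosDefFun fun ξ => ⟪u, displacement (matAct X ξ) u⟫_ℂ *
      Real.exp (-bilin (Y - 1) ξ ξ / 2) := by
  obtain ⟨c, e, norm_e, rfl⟩ : ∃ (c : ℂ) (e : Mode), ‖e‖ = 1 ∧ c • e = u := by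
    obtain rfl | hu := eq_or_ne u 0
    · exact ⟨0, vacuum, norm_vacuum, zero_smul ℂ _⟩
    · exact ⟨‖u‖, (‖u‖⁻¹ : ℂ) • u, norm_smul_inv_norm hu, by
        rw [smul_inv_smul₀]; exact_mod_cast norm_ne_zero_iff.mpr hu⟩
  have posDef := (hΓ.nonclassicalityBreaking_iff_isPosDefFun.mp hNB _
    (isDensity_rankOne_self norm_e)).mul_const (c := (‖c‖ ^ 2 : ℂ)) (by positivity)
  simp_rw [(hasTrace_comp_rankOne _ e e).trace_eq] at posDef
  refine (congrArg IsPosDefFun (funext fun ξ => ?_)).mp posDef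
  rw [map_smul, inner_smul_left, inner_smul_right, ← mul_assoc, Complex.conj_mul']
  ring

theorem bilin_nonneg (hΓ : IsGaussianChannel Γ X Y) (hNB : NonclassicalityBreaking Γ) (ξ : ℂ) :
    0 ≤ bilin (Y - 1) ξ ξ := by
  by_contra! hneg
  set E := Real.exp (-bilin (Y - 1) ξ ξ / 2)
  have one_lt_E : 1 < E := Real.one_lt_exp_iff.mpr (by linarith)
  obtain ⟨u, le_norm_u, hu⟩ :=
    exists_norm_displacement_sub_le (matAct X ξ) (2 * E / (E - 1) + 1)
  have norm_inner_le : ‖⟪u, displacement (matAct X ξ) u⟫_ℂ‖ * E ≤ ‖u‖ ^ 2 := by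
    have norm_le := (hΓ.isPosDefFun_inner hNB u).norm_le ξ
    simpa [displacement_zero, E, -Complex.ofReal_exp] using norm_le
  have E_sub_one_pos : 0 < E - 1 := sub_pos.mpr one_lt_E
  have norm_pos : 0 < ‖u‖ := lt_of_lt_of_le (by positivity) le_norm_u
  have mul_le : (‖u‖ ^ 2 - 2 * ‖u‖) * E ≤ ‖u‖ ^ 2 :=
    (mul_le_mul_of_nonneg_right (sq_norm_sub_two_mul_le hu) (by positivity)).trans norm_inner_le
  have norm_le : ‖u‖ * (E - 1) ≤ 2 * E :=
    le_of_mul_le_mul_left (by linarith) norm_pos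
  rw [← le_div_iff₀ E_sub_one_pos] at norm_le
  linarith

theorem posSemidef_sub_one (hΓ : IsGaussianChannel Γ X Y) (hNB : NonclassicalityBreaking Γ) :
    (Y - 1).PosSemidef :=
  posSemidef_of_bilin_nonneg (hΓ.symm.sub isSymm_one) (hΓ.bilin_nonneg hNB)

open scoped MatrixOrder in
theorem sq_det_le (hΓ : IsGaussianChannel Γ X Y) (hNB : NonclassicalityBreaking Γ) :
    X.det ^ 2 ≤ (Y - 1).det := by
  have Z_posSemidef := hΓ.posSemidef_sub_one hNB
  obtain hX | hX := eq_or_ne X.det 0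
  · rw [hX, sq, zero_mul]
    exact Z_posSemidef.det_nonneg
  have posDef : (Xᴴ * X + (Y - 1)).PosDef :=
    (PosDef.conjTranspose_mul_self X
      (mulVec_injective_of_isUnit ((isUnit_iff_isUnit_det X).mpr hX.isUnit))).add_posSemidef
      Z_posSemidef
  obtain ⟨B, hB, B_eq⟩ :=
    CStarAlgebra.isStrictlyPositive_iff_eq_star_mul_self.mp posDef.isStrictlyPositive
  rw [star_eq_conjTranspose, conjTranspose_eq_transpose_of_trivial,
    conjTranspose_eq_transpose_of_trivial] at B_eq
  have B_det : IsUnit B.det := (isUnit_iff_isUnit_det B).mp hB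
  have congr_eq_one : (X * B⁻¹)ᵀ * (X * B⁻¹) + B⁻¹ᵀ * (Y - 1) * B⁻¹ = 1 := calc
    _ = B⁻¹ᵀ * (Xᵀ * X + (Y - 1)) * B⁻¹ := by rw [transpose_mul]; noncomm_ring
    _ = (B * B⁻¹)ᵀ * (B * B⁻¹) := by rw [B_eq, transpose_mul]; noncomm_ring
    _ = 1 := by rw [mul_nonsing_inv B B_det, transpose_one, Matrix.one_mul]
  have sq_det_le := sq_det_le_det_of_isPosDefFun congr_eq_one <| by
    simp only [matAct_mul, bilin_transpose_mul_mul_self]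
    exact (hΓ.isPosDefFun_inner hNB (coherent 1 - coherent (-1))).comp
      (matAct B⁻¹).toAddMonoidHom
  rw [det_mul, det_mul, det_mul, det_transpose, mul_pow, mul_right_comm, ← sq,
    mul_comm] at sq_det_le
  exact le_of_mul_le_mul_left sq_det_le
    (sq_pos_of_ne_zero (isUnit_nonsing_inv_det B B_det).ne_zero)

end IsGaussianChannel

/-! ### The uncertainty relation of a Gaussian channel -/

/-- The linear functional `T ↦ Tr[B T]` on trace-class operators. -/
noncomputable def traceComp (B : Mode →L[ℂ] Mode) : traceClass →ₗ[ℂ] ℂ where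
  toFun T := trace (B ∘L (T : Mode →L[ℂ] Mode))
  map_add' S T := by
    simpa using ((hasTrace_comp B S).add (hasTrace_comp B T)).trace_eq
  map_smul' c T := by
    simpa using ((hasTrace_comp B T).smul c).trace_eq

/-- The image `D(α) b` of a Hilbert basis under a displacement. -/
noncomputable def displacedBasis {ι : Type*} (α : ℂ) (b : HilbertBasis ι ℂ Mode) :
    HilbertBasis ι ℂ Mode :=
  HilbertBasis.ofRepr ((displacementEquiv α).symm.trans b.repr)

theorem displacedBasis_apply {ι : Type*} (α : ℂ) (b : HilbertBasis ι ℂ Mode) (i : ι) :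
    displacedBasis α b i = displacement α (b i) := by
  classical
  rw [← HilbertBasis.repr_symm_single, ← HilbertBasis.repr_symm_single]
  rfl

theorem hasSum_inner_displacement {ι : Type} (b : HilbertBasis ι ℂ Mode) (T : traceClass)
    (α β : ℂ) :
    HasSum (fun k => ⟪displacement (-α) (b k), (T : Mode →L[ℂ] Mode) (displacement (-β) (b k))⟫_ℂ)
      (Complex.exp (symp α β * Complex.I) *
        trace (displacement (α - β) ∘L (T : Mode →L[ℂ] Mode))) := by
  have hasSum_trace := (hasTrace_comp (displacement (α - β)) T ι (displacedBasis (-β) b)).mul_left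
    (Complex.exp (symp α β * Complex.I))
  refine hasSum_trace.congr_fun fun k => ?_
  have displacement_eq : displacement (-α) (b k) =
      Complex.exp (-(symp α β * Complex.I)) •
        displacement (-(α - β)) (displacement (-β) (b k)) := by
    rw [displacement_displacement, smul_smul, ← Complex.exp_add]
    simp [show β - α + -β = -α by ring]
  rw [displacedBasis_apply, ContinuousLinearMap.comp_apply, displacement_eq, inner_smul_left,
    inner_displacement_left, neg_neg, ← Complex.exp_conj]
  simp

theorem sum_inner_rankOne_nonneg {n : ℕ} (u v : Fin n → Mode) :
    0 ≤ ∑ i, ∑ j, ⟪v i, InnerProductSpace.rankOne ℂ (u i) (u j) (v j)⟫_ℂ := by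
  have sum_eq : ∑ i, ∑ j, ⟪v i, InnerProductSpace.rankOne ℂ (u i) (u j) (v j)⟫_ℂ =
      star (∑ i, ⟪u i, v i⟫_ℂ) * ∑ j, ⟪u j, v j⟫_ℂ := by
    simp only [InnerProductSpace.rankOne_apply, inner_smul_right, star_sum, Finset.sum_mul_sum,
      RCLike.star_def, inner_conj_symm]
    simp only [mul_comm]
  exact sum_eq ▸ star_mul_self_nonneg _

/-- Complete positivity, applied to the block operator `(|u i⟩⟨u j|)` and summed over the vectors
`x i • D(-z i) b k` as `b` runs through a basis. -/
theorem IsChannel.form_trace_displacement_nonneg {Γ : traceClass →ₗ[ℂ] traceClass}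
    (hΓ : IsChannel Γ) {n : ℕ} (u : Fin n → Mode) (z x : Fin n → ℂ) :
    0 ≤ star x ⬝ᵥ (Matrix.of fun i j => Complex.exp (symp (z i) (z j) * Complex.I) *
      traceComp (displacement (z i - z j))
        (Γ ⟨_, rankOne_mem_traceClass (u i) (u j)⟩)) *ᵥ x := by
  obtain ⟨s, b, -⟩ := exists_hilbertBasis ℂ Mode
  have block_nonneg := hΓ.completely_positive n
    (fun i j => ⟨_, rankOne_mem_traceClass (u i) (u j)⟩) (sum_inner_rankOne_nonneg u)
  refine HasSum.nonneg (L := .unconditional s)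
    (fun k => block_nonneg fun i => x i • displacement (-z i) (b k)) ?_
  simp only [dotProduct, mulVec, Finset.mul_sum, map_smul, inner_smul_left, inner_smul_right]
  refine hasSum_sum fun i _ => hasSum_sum fun j _ => ?_
  rw [of_apply, mul_comm _ (x j), mul_left_comm]
  exact ((hasSum_inner_displacement b _ (z i) (z j)).mul_left _).mul_left _

/-- Differentiate the form of `exp (τ H)` at `τ = 0`, where it vanishes because `x` sums to zero. -/
theorem form_nonneg_of_form_exp_nonneg {ι : Type*} [Fintype ι] {H : Matrix ι ι ℂ} {x : ι → ℂ}
    (hx : ∑ i, x i = 0)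
    (hH : ∀ τ : ℝ, 0 < τ → 0 ≤ star x ⬝ᵥ (H.map fun h => Complex.exp (τ * h)) *ᵥ x) :
    0 ≤ star x ⬝ᵥ H *ᵥ x := by
  have form_ones : star x ⬝ᵥ (Matrix.of fun _ _ => 1) *ᵥ x = 0 := by
    simp [mulVec, dotProduct, hx]
  have slope_tendsto : Filter.Tendsto (fun τ : ℝ => (τ : ℂ)⁻¹ •
      (H.map (fun h => Complex.exp (τ * h)) - Matrix.of fun _ _ => 1))
      (nhdsWithin 0 (Set.Ioi 0)) (nhds H) := by
    refine tendsto_pi_nhds.mpr fun i => tendsto_pi_nhds.mpr fun j => ?_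
    have hasDerivAt : HasDerivAt (fun τ : ℝ => Complex.exp (τ * H i j)) (H i j) 0 := by
      simpa using ((Complex.ofRealCLM.hasDerivAt (x := 0)).mul_const (H i j)).cexp
    refine (hasDerivAt.tendsto_slope.mono_left
      (nhdsWithin_mono _ fun τ hτ => ne_of_gt hτ)).congr fun τ => ?_
    simp [slope_def_module]
  have continuous_form : Continuous fun M : Matrix ι ι ℂ => star x ⬝ᵥ M *ᵥ x := by fun_prop
  refine ge_of_tendsto ((continuous_form.tendsto H).comp slope_tendsto)
    (Filter.eventually_of_mem self_mem_nhdsWithin fun τ hτ => ?_)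
  rw [Function.comp_apply, smul_mulVec, dotProduct_smul, sub_mulVec, dotProduct_sub, form_ones,
    sub_zero]
  exact smul_nonneg (by exact_mod_cast (inv_pos.mpr hτ).le) (hH τ hτ)

namespace IsGaussianChannel

variable {Γ : traceClass →ₗ[ℂ] traceClass} {X Y : Matrix (Fin 2) (Fin 2) ℝ}

theorem traceComp_displacement (hΓ : IsGaussianChannel Γ X Y) (ξ : ℂ) (T : traceClass) :
    traceComp (displacement ξ) (Γ T) =
      traceComp (displacement (matAct X ξ)) T * Real.exp (-bilin Y ξ ξ / 2) := by
  have comp_eq : traceComp (displacement ξ) ∘ₗ Γ =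
      (Real.exp (-bilin Y ξ ξ / 2) : ℂ) • traceComp (displacement (matAct X ξ)) :=
    LinearMap.ext_on Submodule.span_span_coe_preimage fun T hT =>
      (hΓ.trace_displacement_out hT ξ).trans (mul_comm _ _)
  rw [mul_comm]
  exact LinearMap.congr_fun comp_eq T

theorem form_gauss_nonneg (hΓ : IsGaussianChannel Γ X Y) {n : ℕ} (z x : Fin n → ℂ) :
    0 ≤ star x ⬝ᵥ (Matrix.of fun i j => Complex.exp (
      ((-bilin Y (z i - z j) (z i - z j) / 2 : ℝ) : ℂ) +
        (((1 - X.det) * symp (z i) (z j) : ℝ) : ℂ) * Complex.I)) *ᵥ x := by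
  refine (hΓ.form_trace_displacement_nonneg
    (fun i => displacement (-matAct X (z i)) vacuum) z x).trans_eq ?_
  congr 2
  ext i j
  have trace_eq : traceComp (displacement (matAct X (z i - z j)))
      ⟨_, rankOne_mem_traceClass (displacement (-matAct X (z i)) vacuum)
        (displacement (-matAct X (z j)) vacuum)⟩ =
      Complex.exp (-(X.det * symp (z i) (z j) : ℝ) * Complex.I) := by
    refine (hasTrace_comp_rankOne _ _ _).trace_eq.trans ?_
    rw [displacement_displacement, inner_smul_right, map_sub, sub_add_eq_add_sub, add_neg_cancel,
      zero_sub, inner_displacement_displacement, inner_self_eq_norm_sq_to_K, norm_vacuum,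
      ← symp_matAct, symp_swap (matAct X (z i))]
    simp
  rw [of_apply, of_apply, hΓ.traceComp_displacement, trace_eq, Complex.ofReal_exp,
    ← Complex.exp_add, ← Complex.exp_add]
  congr 1
  push_cast
  ring

/-- The substitution `z ↦ √τ z` scales the exponent by `τ`, and the diagonal terms of `Y` are
absorbed into `x`. -/
theorem form_exp_nonneg (hΓ : IsGaussianChannel Γ X Y) {n : ℕ} (z x : Fin n → ℂ) {τ : ℝ}
    (hτ : 0 ≤ τ) :
    0 ≤ star x ⬝ᵥ (Matrix.of fun i j => Complex.exp (τ *
      (bilin Y (z i) (z j) + ((1 - X.det) * symp (z i) (z j) : ℝ) * Complex.I))) *ᵥ x := by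
  have symm : Y 1 0 = Y 0 1 := hΓ.symm.apply 0 1
  have form_nonneg := hΓ.form_gauss_nonneg (fun i => √τ • z i)
    (fun i => Real.exp (τ * bilin Y (z i) (z i) / 2) * x i)
  have exponent_eq (i j : Fin n) :
      (τ * (bilin Y (z i) (z j) + ((1 - X.det) * symp (z i) (z j) : ℝ) * Complex.I) : ℂ) =
      (τ * bilin Y (z i) (z i) / 2 : ℝ) +
        ((-bilin Y (√τ • z i - √τ • z j) (√τ • z i - √τ • z j) / 2 : ℝ) +
        ((1 - X.det) * symp (√τ • z i) (√τ • z j) : ℝ) * Complex.I) +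
      (τ * bilin Y (z j) (z j) / 2 : ℝ) := by
    have bilin_swap : bilin Y (z j) (z i) = bilin Y (z i) (z j) := by
      simp only [bilin_apply, symm]
      ring
    rw [← smul_sub]
    simp only [map_smul, LinearMap.smul_apply, map_sub, LinearMap.sub_apply, bilin_swap,
      smul_eq_mul]
    have sq_sqrt : (√τ ^ 2 : ℂ) = τ := by exact_mod_cast Real.sq_sqrt hτ
    push_cast
    linear_combination (((bilin Y (z i) (z i) + bilin Y (z j) (z j)) / 2 - bilin Y (z i) (z j) -
      (1 - X.det) * symp (z i) (z j) * Complex.I : ℂ)) * sq_sqrt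
  refine form_nonneg.trans_eq ?_
  simp only [dotProduct, mulVec, of_apply, exponent_eq, Complex.exp_add, Finset.mul_sum,
    Pi.star_apply, star_mul', RCLike.star_def, Complex.conj_ofReal, ← Complex.ofReal_exp]
  refine Finset.sum_congr rfl fun i _ => Finset.sum_congr rfl fun j _ => ?_
  ring

theorem form_nonneg (hΓ : IsGaussianChannel Γ X Y) {n : ℕ} (z x : Fin n → ℂ) :
    0 ≤ star x ⬝ᵥ (Matrix.of fun i j =>
      (bilin Y (z i) (z j) + ((1 - X.det) * symp (z i) (z j) : ℝ) * Complex.I : ℂ)) *ᵥ x := by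
  have padded_form_nonneg := form_nonneg_of_form_exp_nonneg (x := vecCons (-∑ i, x i) x)
    (H := Matrix.of fun i j => (bilin Y (vecCons 0 z i) (vecCons 0 z j) +
      ((1 - X.det) * symp (vecCons 0 z i) (vecCons 0 z j) : ℝ) * Complex.I : ℂ))
    (by simp [Fin.sum_univ_succ]) fun τ hτ => hΓ.form_exp_nonneg _ _ hτ.le
  simpa [dotProduct, mulVec, Fin.sum_univ_succ] using padded_form_nonneg

theorem posSemidef (hΓ : IsGaussianChannel Γ X Y) : Y.PosSemidef := by
  refine posSemidef_of_bilin_nonneg hΓ.symm fun ξ => ?_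
  simpa [dotProduct, mulVec] using hΓ.form_nonneg ![ξ] 1

theorem sq_one_sub_det_le (hΓ : IsGaussianChannel Γ X Y) : (1 - X.det) ^ 2 ≤ Y.det := by
  have symm : Y 1 0 = Y 0 1 := hΓ.symm.apply 0 1
  have posSemidef : (!![(Y 0 0 : ℂ), ⟨Y 0 1, X.det - 1⟩;
      ⟨Y 0 1, 1 - X.det⟩, (Y 1 1 : ℂ)]).PosSemidef := by
    refine PosSemidef.of_dotProduct_mulVec_nonneg ?_ fun x => ?_
    · ext i j
      fin_cases i <;> fin_cases j <;> simp [Complex.ext_iff]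
    · refine (hΓ.form_nonneg ![1, Complex.I] x).trans_eq ?_
      congr 2
      ext i j
      fin_cases i <;> fin_cases j <;> simp [bilin_apply, symp_apply, symm, Complex.ext_iff]
  have det_nonneg := posSemidef.det_nonneg
  rw [det_fin_two_of] at det_nonneg
  have det_re_nonneg : Y 0 1 * Y 0 1 ≤ Y 0 0 * Y 1 1 + (X.det - 1) * (1 - X.det) := by
    simpa using (Complex.nonneg_iff.mp det_nonneg).1
  rw [det_fin_two Y, symm]
  linarith

end IsGaussianChannel

/-! ### Canonical forms -/

theorem mul_symplecticForm_mul_transpose (S : Matrix (Fin 2) (Fin 2) ℝ) :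
    S * symplecticForm * Sᵀ = S.det • symplecticForm := by
  ext i j
  fin_cases i <;> fin_cases j <;>
    simp [symplecticForm, mul_apply, Fin.sum_univ_two, det_fin_two] <;> ring

theorem mul_symplecticForm_mul_transpose_eq_iff {S : Matrix (Fin 2) (Fin 2) ℝ} :
    S * symplecticForm * Sᵀ = symplecticForm ↔ S.det = 1 := by
  rw [mul_symplecticForm_mul_transpose]
  refine ⟨fun h => ?_, fun h => by rw [h, one_smul]⟩
  simpa [symplecticForm] using congr_fun₂ h 0 1

namespace HasForm

variable {X Y X₀ Y₀ : Matrix (Fin 2) (Fin 2) ℝ}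

theorem det_left_eq (h : HasForm X Y X₀ Y₀) : X₀.det = X.det := by
  obtain ⟨S, R, hS, hR, rfl, -⟩ := h
  rw [det_mul, det_mul, mul_symplecticForm_mul_transpose_eq_iff.mp hS,
    (mem_specialOrthogonalGroup_iff.mp hR).2, one_mul, mul_one]

theorem det_right_eq (h : HasForm X Y X₀ Y₀) : Y₀.det = Y.det := by
  obtain ⟨S, R, -, hR, -, rfl⟩ := h
  rw [det_mul, det_mul, det_transpose, (mem_specialOrthogonalGroup_iff.mp hR).2, one_mul, mul_one]

theorem posSemidef_iff (h : HasForm X Y X₀ Y₀) : Y₀.PosSemidef ↔ Y.PosSemidef := by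
  obtain ⟨S, R, -, hR, -, rfl⟩ := h
  have isUnit : IsUnit R := by
    rw [isUnit_iff_isUnit_det, (mem_specialOrthogonalGroup_iff.mp hR).2]
    exact isUnit_one
  exact isUnit.posSemidef_star_left_conjugate_iff

theorem sub_one (h : HasForm X Y X₀ Y₀) : HasForm X (Y - 1) X₀ (Y₀ - 1) := by
  obtain ⟨S, R, hS, hR, hX, rfl⟩ := h
  have orthogonal : Rᵀ * R = 1 :=
    (mem_orthogonalGroup_iff' (Fin 2) ℝ).mp (mem_specialOrthogonalGroup_iff.mp hR).1
  exact ⟨S, R, hS, hR, hX, by rw [Matrix.mul_sub, Matrix.sub_mul, Matrix.mul_one, orthogonal]⟩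

end HasForm

/-- The rotation is by half the argument of the traceless part of `Y`, read as a complex number. -/
theorem exists_rotation_diagonal {Y : Matrix (Fin 2) (Fin 2) ℝ} (hY : Y.IsSymm) :
    ∃ R ∈ specialOrthogonalGroup (Fin 2) ℝ, ∃ a b : ℝ, Rᵀ * Y * R = diagonal ![a, b] := by
  have symm : Y 1 0 = Y 0 1 := hY.apply 0 1
  let z : ℂ := ⟨(Y 0 0 - Y 1 1) / 2, Y 0 1⟩
  set c := Real.cos (z.arg / 2)
  set s := Real.sin (z.arg / 2)
  have re_eq : ‖z‖ * (c ^ 2 - s ^ 2) = (Y 0 0 - Y 1 1) / 2 := by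
    rw [← Real.cos_two_mul', mul_div_cancel₀ _ two_ne_zero]
    exact Complex.norm_mul_cos_arg z
  have im_eq : ‖z‖ * (2 * s * c) = Y 0 1 := by
    rw [← Real.sin_two_mul, mul_div_cancel₀ _ two_ne_zero]
    exact Complex.norm_mul_sin_arg z
  have off_diagonal : Y 0 1 * (c ^ 2 - s ^ 2) + (Y 1 1 - Y 0 0) * (c * s) = 0 := by
    linear_combination -(c ^ 2 - s ^ 2) * im_eq + 2 * c * s * re_eq
  refine ⟨!![c, -s; s, c], by simp [c, s],
    Y 0 0 * c ^ 2 + 2 * Y 0 1 * (c * s) + Y 1 1 * s ^ 2,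
    Y 0 0 * s ^ 2 - 2 * Y 0 1 * (c * s) + Y 1 1 * c ^ 2, ?_⟩
  ext i j
  fin_cases i <;> fin_cases j <;> simp [mul_apply, Fin.sum_univ_two, symm]
  · ring
  · linear_combination off_diagonal
  · linear_combination off_diagonal
  · ring

theorem exists_rotation_col_one_eq_zero {X : Matrix (Fin 2) (Fin 2) ℝ} (hX : X.det = 0) :
    ∃ R ∈ specialOrthogonalGroup (Fin 2) ℝ, ∀ i, (X * R) i 1 = 0 := by
  obtain ⟨v, v_ne, hv⟩ := exists_mulVec_eq_zero_iff.mpr hX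
  set n := √(v 0 ^ 2 + v 1 ^ 2)
  have norm_sq_pos : 0 < v 0 ^ 2 + v 1 ^ 2 := by
    simpa [dotProduct, sq] using dotProduct_star_self_pos_iff.mpr v_ne
  have sq_n : n ^ 2 = v 0 ^ 2 + v 1 ^ 2 := Real.sq_sqrt norm_sq_pos.le
  refine ⟨!![v 1 / n, v 0 / n; -(v 0 / n), v 1 / n], ?_, fun i => ?_⟩
  · rw [of_mem_specialOrthogonalGroup_fin_two_iff, div_pow, div_pow, ← add_div, sq_n, add_comm,
      div_self norm_sq_pos.ne']
    simp
  · have kernel : X i 0 * v 0 + X i 1 * v 1 = 0 := by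
      simpa [mulVec, dotProduct] using congr_fun hv i
    simp [mul_apply, ← mul_div_assoc, ← add_div, kernel]

theorem exists_det_eq_one_mulVec_eq {u : Fin 2 → ℝ} (hu : u ≠ 0) :
    ∃ S : Matrix (Fin 2) (Fin 2) ℝ, S.det = 1 ∧ S *ᵥ u = ![1, 0] := by
  have norm_sq_pos : 0 < u 0 ^ 2 + u 1 ^ 2 := by
    simpa [dotProduct, sq] using dotProduct_star_self_pos_iff.mpr hu
  refine ⟨!![u 0 / (u 0 ^ 2 + u 1 ^ 2), u 1 / (u 0 ^ 2 + u 1 ^ 2); -u 1, u 0], ?_, ?_⟩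
  · rw [det_fin_two_of]
    field_simp
    ring
  · ext i
    fin_cases i <;> simp [mulVec, dotProduct]
    · field_simp
    · ring

section CanonicalForm

variable {X Y X₀ : Matrix (Fin 2) (Fin 2) ℝ}

theorem exists_hasForm_of_det_eq (hY : Y.IsSymm) (hX : X.det ≠ 0) (hX₀ : X₀.det = X.det) :
    ∃ a b : ℝ, HasForm X Y X₀ (diagonal ![a, b]) := by
  obtain ⟨R, hR, a, b, hRY⟩ := exists_rotation_diagonal hY
  have det_eq : (X * R).det = X.det := by
    rw [det_mul, (mem_specialOrthogonalGroup_iff.mp hR).2, mul_one]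
  refine ⟨a, b, X₀ * (X * R)⁻¹, R, mul_symplecticForm_mul_transpose_eq_iff.mpr ?_, hR, ?_, hRY⟩
  · rw [det_mul, det_nonsing_inv, det_eq, hX₀, Ring.mul_inverse_cancel _ hX.isUnit]
  · rw [Matrix.mul_assoc, Matrix.mul_assoc, nonsing_inv_mul _ (det_eq ▸ hX.isUnit),
      Matrix.mul_one]

theorem exists_hasForm_smul_one (hY : Y.IsSymm) (hX : 0 < X.det) :
    ∃ κ a b : ℝ, 0 < κ ∧ HasForm X Y (κ • 1) (diagonal ![a, b]) := by
  obtain ⟨a, b, h⟩ := exists_hasForm_of_det_eq (X₀ := √X.det • 1) hY hX.ne' <| by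
    simp [Real.sq_sqrt hX.le]
  exact ⟨√X.det, a, b, Real.sqrt_pos.mpr hX, h⟩

theorem det_smul_sigma3 (κ : ℝ) : (κ • sigma3).det = -κ ^ 2 := by
  simp [sigma3]

theorem exists_hasForm_smul_sigma3 (hY : Y.IsSymm) (hX : X.det < 0) :
    ∃ κ a b : ℝ, 0 < κ ∧ HasForm X Y (κ • sigma3) (diagonal ![a, b]) := by
  have neg_det_pos : 0 < -X.det := neg_pos.mpr hX
  obtain ⟨a, b, h⟩ := exists_hasForm_of_det_eq (X₀ := √(-X.det) • sigma3) hY hX.ne <| by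
    rw [det_smul_sigma3, Real.sq_sqrt neg_det_pos.le, neg_neg]
  exact ⟨√(-X.det), a, b, Real.sqrt_pos.mpr neg_det_pos, h⟩

theorem exists_hasForm_diagonal_one_zero (hX : X.det = 0) (X_ne : X ≠ 0) :
    ∃ Y₀, HasForm X Y (diagonal ![1, 0]) Y₀ := by
  obtain ⟨R, hR, col_one⟩ := exists_rotation_col_one_eq_zero hX
  have isUnit_det : IsUnit R.det := (mem_specialOrthogonalGroup_iff.mp hR).2 ▸ isUnit_one
  have col_zero_ne : (X * R).col 0 ≠ 0 := by
    intro col_zero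
    have mul_eq_zero : X * R = 0 := by
      ext i j
      fin_cases j
      exacts [congr_fun col_zero i, col_one i]
    rw [← mul_nonsing_inv_cancel_right R X isUnit_det, mul_eq_zero, Matrix.zero_mul] at X_ne
    exact X_ne rfl
  obtain ⟨S, hS, S_col_zero⟩ := exists_det_eq_one_mulVec_eq col_zero_ne
  refine ⟨_, S, R, mul_symplecticForm_mul_transpose_eq_iff.mpr hS, hR, ?_, rfl⟩
  rw [Matrix.mul_assoc]
  ext i j
  fin_cases j
  · refine (congr_fun S_col_zero i).trans ?_
    fin_cases i <;> simp
  · rw [Matrix.mul_apply]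
    fin_cases i <;> simp [col_one]

theorem exists_hasForm_zero (hY : Y.IsSymm) : ∃ a b : ℝ, HasForm 0 Y 0 (diagonal ![a, b]) := by
  obtain ⟨R, hR, a, b, hRY⟩ := exists_rotation_diagonal hY
  exact ⟨a, b, 1, R, mul_symplecticForm_mul_transpose_eq_iff.mpr det_one, hR, by simp, hRY⟩

end CanonicalForm

/-! ### Criteria for the canonical forms -/

theorem posSemidef_sub_smul_one_iff_le_eigenvalue {n : Type*} [Fintype n] [DecidableEq n]
    {Y : Matrix n n ℝ} (hY : Y.IsSymm) {c : ℝ} :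
    (Y - c • 1).PosSemidef ↔ ∀ μ : ℝ, Module.End.HasEigenvalue (Matrix.toLin' Y) μ → c ≤ μ := by
  have isHermitian : (Y - c • 1).IsHermitian := hY.sub (isSymm_one.smul c)
  rw [posSemidef_iff_isHermitian_and_spectrum_nonneg, and_iff_right isHermitian,
    ← Algebra.algebraMap_eq_smul_one, ← spectrum.sub_singleton_eq]
  simp [Set.subset_def, Module.End.hasEigenvalue_iff_mem_spectrum, spectrum_toLin']

theorem posSemidef_diagonal_sub_one_iff {a b : ℝ} :
    (diagonal ![a, b] - 1).PosSemidef ↔ 1 ≤ a ∧ 1 ≤ b := by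
  rw [← diagonal_one, diagonal_sub, posSemidef_diagonal_iff]
  simp [Fin.forall_fin_two]

theorem harmonic_le_iff {k a b : ℝ} (hk : 0 < k) :
    (0 < a + k - 1 ∧ 0 < b + k - 1 ∧ 1 / (a + k - 1) + 1 / (b + k - 1) ≤ 1 / k) ↔
      1 < a ∧ 1 < b ∧ k ^ 2 ≤ (a - 1) * (b - 1) := by
  have clear_denominators {p q : ℝ} (hp : 0 < p) (hq : 0 < q) :
      1 / p + 1 / q ≤ 1 / k ↔ k * (p + q) ≤ p * q := by
    rw [div_add_div _ _ hp.ne' hq.ne', div_le_div_iff₀ (mul_pos hp hq) hk]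
    constructor <;> intro h <;> linarith
  constructor
  · rintro ⟨ha, hb, h⟩
    rw [clear_denominators ha hb] at h
    refine ⟨?_, ?_, by linarith⟩
    · by_contra! ha_le
      nlinarith [mul_pos hk ha]
    · by_contra! hb_le
      nlinarith [mul_pos hk hb]
  · rintro ⟨ha, hb, h⟩
    have ha_pos : 0 < a + k - 1 := by linarith
    have hb_pos : 0 < b + k - 1 := by linarith
    exact ⟨ha_pos, hb_pos, (clear_denominators ha_pos hb_pos).mpr (by linarith)⟩

/-- With `m = (a + b) / 2`, AM-GM turns the two inequalities into `d ≤ 1 - m` and `1 - d ≤ m`. -/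
theorem eq_one_sub_of_uncertainty {d a b : ℝ} (ha : 0 ≤ a) (hb : 0 ≤ b) (ha_lt : a < 1)
    (hb_lt : b < 1) (uncertainty : (1 - d) ^ 2 ≤ a * b) (h : d ^ 2 ≤ (a - 1) * (b - 1)) :
    0 < d ∧ a = 1 - d ∧ b = 1 - d := by
  have d_le : d ≤ 1 - (a + b) / 2 :=
    (abs_le_of_sq_le_sq' (by linarith [sq_nonneg (a - b)]) (by linarith)).2
  have le_d : 1 - d ≤ (a + b) / 2 :=
    (abs_le_of_sq_le_sq' (by linarith [sq_nonneg (a - b)]) (by linarith)).2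
  obtain rfl : d = 1 - (a + b) / 2 := by linarith
  have sub_eq_zero : a - b = 0 := pow_eq_zero_iff two_ne_zero |>.mp <|
    le_antisymm (by linarith) (sq_nonneg _)
  exact ⟨by linarith, by linarith, by linarith⟩

theorem IsGaussianChannel.nonclassicalityBreaking_iff {Γ : traceClass →ₗ[ℂ] traceClass}
    {X Y : Matrix (Fin 2) (Fin 2) ℝ} (hΓ : IsGaussianChannel Γ X Y) :
    NonclassicalityBreaking Γ ↔ (Y - 1).PosSemidef ∧ X.det ^ 2 ≤ (Y - 1).det :=
  ⟨fun hNB => ⟨hΓ.posSemidef_sub_one hNB, hΓ.sq_det_le hNB⟩,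
    fun ⟨hY, hd⟩ => hΓ.nonclassicalityBreaking hY hd⟩

namespace HasForm

variable {Γ : traceClass →ₗ[ℂ] traceClass} {X Y X₀ Y₀ : Matrix (Fin 2) (Fin 2) ℝ} {a b : ℝ}

theorem nonclassicalityBreaking_iff (h : HasForm X Y X₀ Y₀) (hΓ : IsGaussianChannel Γ X Y) :
    NonclassicalityBreaking Γ ↔ (Y₀ - 1).PosSemidef ∧ X₀.det ^ 2 ≤ (Y₀ - 1).det := by
  rw [hΓ.nonclassicalityBreaking_iff, h.sub_one.posSemidef_iff, h.sub_one.det_right_eq,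
    h.det_left_eq]

theorem nonclassicalityBreaking_iff_posSemidef (h : HasForm X Y X₀ Y₀)
    (hΓ : IsGaussianChannel Γ X Y) (hX₀ : X₀.det = 0) :
    NonclassicalityBreaking Γ ↔ (Y₀ - 1).PosSemidef := by
  rw [h.nonclassicalityBreaking_iff hΓ, hX₀, zero_pow two_ne_zero]
  exact and_iff_left_of_imp PosSemidef.det_nonneg

theorem nonclassicalityBreaking_iff_one_lt (h : HasForm X Y X₀ (diagonal ![a, b]))
    (hΓ : IsGaussianChannel Γ X Y) (hX₀ : X₀.det ≠ 0) :
    NonclassicalityBreaking Γ ↔ 1 < a ∧ 1 < b ∧ X₀.det ^ 2 ≤ (a - 1) * (b - 1) := by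
  have det_eq : (diagonal ![a, b] - 1).det = (a - 1) * (b - 1) := by simp [det_fin_two]
  have sq_det_pos : 0 < X₀.det ^ 2 := by positivity
  rw [h.nonclassicalityBreaking_iff hΓ, posSemidef_diagonal_sub_one_iff, det_eq, and_assoc]
  refine ⟨fun ⟨ha, hb, hd⟩ => ⟨ha.lt_of_ne ?_, hb.lt_of_ne ?_, hd⟩,
    fun ⟨ha, hb, hd⟩ => ⟨ha.le, hb.le, hd⟩⟩ <;> rintro rfl <;> linarith

theorem nonclassicalityBreaking_iff_harmonic_le (h : HasForm X Y X₀ (diagonal ![a, b]))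
    (hΓ : IsGaussianChannel Γ X Y) (hX₀ : X₀.det ≠ 0) :
    NonclassicalityBreaking Γ ↔ 0 < a + |X₀.det| - 1 ∧ 0 < b + |X₀.det| - 1 ∧
      1 / (a + |X₀.det| - 1) + 1 / (b + |X₀.det| - 1) ≤ 1 / |X₀.det| := by
  rw [h.nonclassicalityBreaking_iff_one_lt hΓ hX₀, harmonic_le_iff (abs_pos.mpr hX₀), sq_abs]

theorem nonclassicalityBreaking_iff_sq_det_le (h : HasForm X Y X₀ (diagonal ![a, b]))
    (hΓ : IsGaussianChannel Γ X Y) (hX₀ : X₀.det ≠ 0)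
    (hne : 0 < X₀.det → ¬ (a = 1 - X₀.det ∧ b = 1 - X₀.det)) :
    NonclassicalityBreaking Γ ↔ X₀.det ^ 2 ≤ (a - 1) * (b - 1) := by
  rw [h.nonclassicalityBreaking_iff_one_lt hΓ hX₀]
  refine ⟨fun ⟨_, _, hd⟩ => hd, fun hd => ?_⟩
  have sq_det_pos : 0 < X₀.det ^ 2 := by positivity
  have nonneg := posSemidef_diagonal_iff.mp (h.posSemidef_iff.mpr hΓ.posSemidef)
  have uncertainty : (1 - X₀.det) ^ 2 ≤ a * b := by
    simpa [h.det_left_eq, ← h.det_right_eq] using hΓ.sq_one_sub_det_le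
  rcases pos_and_pos_or_neg_and_neg_of_mul_pos (sq_det_pos.trans_le hd) with
    ⟨ha, hb⟩ | ⟨ha, hb⟩
  · exact ⟨sub_pos.mp ha, sub_pos.mp hb, hd⟩
  · obtain ⟨det_pos, eq_one_sub⟩ := eq_one_sub_of_uncertainty (nonneg 0) (nonneg 1)
      (sub_neg.mp ha) (sub_neg.mp hb) uncertainty hd
    exact absurd eq_one_sub (hne det_pos)

end HasForm

end SingleMode

theorem mainTheorem2 (Γ : traceClass →ₗ[ℂ] traceClass) (X Y : Matrix (Fin 2) (Fin 2) ℝ)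
    (hΓ : IsGaussianChannel Γ X Y) :
    -- every Gaussian channel has one of the canonical forms, according to `det X`
    (0 < X.det → ∃ κ a b : ℝ, 0 < κ ∧
      HasForm X Y (κ • (1 : Matrix (Fin 2) (Fin 2) ℝ)) (diagonal ![a, b])) ∧
    (X.det < 0 → ∃ κ a b : ℝ, 0 < κ ∧ HasForm X Y (κ • sigma3) (diagonal ![a, b])) ∧
    (X.det = 0 → X ≠ 0 → ∃ Y₀ : Matrix (Fin 2) (Fin 2) ℝ,
      HasForm X Y (diagonal ![1, 0]) Y₀) ∧
    (X = 0 → ∃ a b : ℝ, HasForm X Y 0 (diagonal ![a, b])) ∧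
    -- first canonical form
    (∀ κ a b : ℝ, 0 < κ →
      HasForm X Y (κ • (1 : Matrix (Fin 2) (Fin 2) ℝ)) (diagonal ![a, b]) →
      (NonclassicalityBreaking Γ ↔ 1 < a ∧ 1 < b ∧ κ ^ 4 ≤ (a - 1) * (b - 1)) ∧
      (NonclassicalityBreaking Γ ↔
        0 < a + κ ^ 2 - 1 ∧ 0 < b + κ ^ 2 - 1 ∧
          1 / (a + κ ^ 2 - 1) + 1 / (b + κ ^ 2 - 1) ≤ 1 / κ ^ 2) ∧
      (¬ (a = 1 - κ ^ 2 ∧ b = 1 - κ ^ 2) →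
        (NonclassicalityBreaking Γ ↔ κ ^ 4 ≤ (a - 1) * (b - 1)))) ∧
    -- second canonical form
    (∀ κ a b : ℝ, 0 < κ → HasForm X Y (κ • sigma3) (diagonal ![a, b]) →
      (NonclassicalityBreaking Γ ↔ κ ^ 4 ≤ (a - 1) * (b - 1)) ∧
      (NonclassicalityBreaking Γ ↔
        0 < a + κ ^ 2 - 1 ∧ 0 < b + κ ^ 2 - 1 ∧
          1 / (a + κ ^ 2 - 1) + 1 / (b + κ ^ 2 - 1) ≤ 1 / κ ^ 2)) ∧
    -- third canonical form, singular `X ≠ 0`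
    (∀ Y₀ : Matrix (Fin 2) (Fin 2) ℝ, HasForm X Y (diagonal ![1, 0]) Y₀ →
      (NonclassicalityBreaking Γ ↔ (Y₀ - 1).PosSemidef) ∧
      (NonclassicalityBreaking Γ ↔
        ∀ μ : ℝ, Module.End.HasEigenvalue (Matrix.toLin' Y) μ → 1 ≤ μ)) ∧
    -- third canonical form, `X = 0`
    (∀ a b : ℝ, HasForm X Y 0 (diagonal ![a, b]) →
      (NonclassicalityBreaking Γ ↔ 1 ≤ a ∧ 1 ≤ b)) := by
  have det_smul_one (κ : ℝ) : (κ • (1 : Matrix (Fin 2) (Fin 2) ℝ)).det = κ ^ 2 := by simp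
  have sq_sq (κ : ℝ) : (κ ^ 2) ^ 2 = κ ^ 4 := by ring
  refine ⟨exists_hasForm_smul_one hΓ.symm, exists_hasForm_smul_sigma3 hΓ.symm,
    exists_hasForm_diagonal_one_zero, ?_, fun κ a b hκ h => ?_, fun κ a b hκ h => ?_,
    fun Y₀ h => ?_, fun a b h => ?_⟩
  · rintro rfl
    exact exists_hasForm_zero hΓ.symm
  · have det_ne := (det_smul_one κ).trans_ne (pow_pos hκ 2).ne'
    have one_lt_iff := h.nonclassicalityBreaking_iff_one_lt hΓ det_ne
    have harmonic_iff := h.nonclassicalityBreaking_iff_harmonic_le hΓ det_ne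
    have sq_det_iff := h.nonclassicalityBreaking_iff_sq_det_le hΓ det_ne
    simp only [det_smul_one, abs_sq, sq_sq] at one_lt_iff harmonic_iff sq_det_iff
    exact ⟨one_lt_iff, harmonic_iff, fun hne => sq_det_iff fun _ => hne⟩
  · have det_neg := (det_smul_sigma3 κ).trans_lt (neg_neg_of_pos (pow_pos hκ 2))
    have sq_det_iff := h.nonclassicalityBreaking_iff_sq_det_le hΓ det_neg.ne fun det_pos =>
      absurd det_pos det_neg.not_gt
    have harmonic_iff := h.nonclassicalityBreaking_iff_harmonic_le hΓ det_neg.ne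
    simp only [det_smul_sigma3, even_two.neg_pow, sq_sq, abs_neg, abs_sq]
      at sq_det_iff harmonic_iff
    exact ⟨sq_det_iff, harmonic_iff⟩
  · have posSemidef_iff := h.nonclassicalityBreaking_iff_posSemidef hΓ (by simp)
    refine ⟨posSemidef_iff, posSemidef_iff.trans (h.sub_one.posSemidef_iff.trans ?_)⟩
    simpa using posSemidef_sub_smul_one_iff_le_eigenvalue hΓ.symm (c := 1)
  · exact (h.nonclassicalityBreaking_iff_posSemidef hΓ (by simp)).trans
      posSemidef_diagonal_sub_one_iff
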